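/- A rank 3 simple matroid $M$ is a finite set $E$ of elements together with a set $F$ of at least two subsets of $E$, called flats, each with at least two elements, such that any two distinct elements lie in exactly one flat. Let $\Gamma_M$ be the bipartite graph with vertex set $E\sqcup F$ and an edge of length $1$ between $e\in E$ and $f\in F$ whenever $e\in f$, and let $D_M=\sum_{e\in E}[e]$, a divisor of degree $d=|E|$. Let $k$ be an algebraically closed field. A lift $\mathfrak C$ of $\Gamma_M$ to a metrized complex with rational components consists of a copy $C_v$ of $\mathbb P^1_k$ for each vertex $v$ and, for each edge $a$ at $v$, a point $x_v^a\in C_v(k)$, distinct edges at $v$ having distinct points. The points of $\mathfrak C$ are the points of the $C_v(k)$ and the points in the interiors of the edges (an edge being glued to the curves at its points $x_v^a$); divisors are finite formal integral sums of points. A rational function $\mathfrak f$ on $\mathfrak C$ is a continuous, piecewise affine function $f_\Gamma$ with integer slopes on the metric graph $\Gamma_M$ together with a nonzero rational function $f_v$ on each $C_v$. The coefficient of $\operatorname{div}\mathfrak f$ at an interior point of an edge is minus the sum of the outgoing slopes of $f_\Gamma$; at a point $x\in C_v(k)$ it is $\operatorname{ord}_x(f_v)$, minus the outgoing slope of $f_\Gamma$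 at $v$ along $a$ if $x=x_v^a$. A limit $g^r_d$ on $\mathfrak C$ is given by a pair $(\mathcal D,(H_v)_v)$ of a divisor $\mathcal D$ of degree $d$ and $(r+1)$-dimensional $k$-vector spaces $H_v$ of rational functions on $C_v$, such that $r$ is the largest integer $s$ with the property: for every effective divisor $\mathcal E$ of degree $s$ on $\mathfrak C$ there is a rational function $\mathfrak f$ with $f_v\in H_v$ for all $v$ and $\mathcal D-\mathcal E+\operatorname{div}\mathfrak f\ge 0$. A lift of $D_M$ to $\mathfrak C$ is a divisor $\mathcal D=\sum_{e\in E}(x_e)$ with $x_e\in C_e(k)$. **Proposition.** For every rank 3 simple matroid $M$ and every lift $\mathfrak C$ of $\Gamma_M$ to a metrized complex with rational components over $k$, there are a lift $\mathcal D$ of $D_M$ to $\mathfrak C$ and spaces $(H_v)_v$ such that $(\mathcal D,(H_v)_v)$ is a limit $g^2_d$, $d=|E|$. More precisely, let $\mathcal D=\sum_e (x_e)$ be any lift of $D_M$. For each flat $f$ choose any two distinct elements of $f$, and let $p_{f,1},p_{f,2}\in C_f$ be the points of the edges from $f$ to them; for each element $e$ choose any flat containing $e$, and let $q_e\in C_e$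 be the point of the edge from $e$ to it. Put $H_f=L(p_{f,1}+p_{f,2})$ and $H_e=L(q_e+x_e)$, where $L(P+Q)$ is the space of rational functions $\varphi$ with $\varphi=0$ or $\operatorname{div}\varphi+P+Q\ge0$. Then $(\mathcal D,(H_v)_v)$ is a limit $g^2_d$. -/

import Mathlib

noncomputable section

/-! ## The projective line

Points of the projective line over `k` are `OnePoint k`, that is `k ∪ {∞}`
(compare `OnePoint.equivProjectivization`), and its function field is `RatFunc k`. -/

namespace ProjLine

variable {k : Type*} [Field k]

/-- The order of vanishing of a (nonzero) rational function at a point of the projective line.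
At `∞` it is the degree of the denominator minus the degree of the numerator. -/
def ordAt (φ : RatFunc k) : OnePoint k → ℤ
  | OnePoint.some a => (φ.num.rootMultiplicity a : ℤ) - (φ.denom.rootMultiplicity a : ℤ)
  | OnePoint.infty => -φ.intDegree

theorem ordAt_add_ge {φ ψ : RatFunc k} (hφ : φ ≠ 0) (hψ : ψ ≠ 0) (h : φ + ψ ≠ 0)
    (x : OnePoint k) : min (ordAt φ x) (ordAt ψ x) ≤ ordAt (φ + ψ) x := by
  induction x with
  | infty =>
    have := RatFunc.intDegree_add_le hψ h
    change min (-φ.intDegree) (-ψ.intDegree) ≤ -(φ + ψ).intDegree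
    omega
  | coe a =>
    have hn := RatFunc.num_ne_zero hφ
    have hm := RatFunc.num_ne_zero hψ
    have hs := RatFunc.num_ne_zero h
    have hd := RatFunc.denom_ne_zero φ
    have he := RatFunc.denom_ne_zero ψ
    have ht := RatFunc.denom_ne_zero (φ + ψ)
    have key := RatFunc.num_denom_add φ ψ
    have hl : (φ + ψ).num * (φ.denom * ψ.denom) ≠ 0 := mul_ne_zero hs (mul_ne_zero hd he)
    have hr := hl
    rw [key] at hr
    have hsum := left_ne_zero_of_mul hr
    have key2 := congrArg (Polynomial.rootMultiplicity a) key
    rw [Polynomial.rootMultiplicity_mul hl, Polynomial.rootMultiplicity_mul hr,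
      Polynomial.rootMultiplicity_mul (mul_ne_zero hd he)] at key2
    have key3 := Polynomial.rootMultiplicity_add (a := a) hsum
    rw [Polynomial.rootMultiplicity_mul (mul_ne_zero hn he),
      Polynomial.rootMultiplicity_mul (mul_ne_zero hd hm)] at key3
    change min ((φ.num.rootMultiplicity a : ℤ) - (φ.denom.rootMultiplicity a : ℤ))
      ((ψ.num.rootMultiplicity a : ℤ) - (ψ.denom.rootMultiplicity a : ℤ)) ≤
      ((φ + ψ).num.rootMultiplicity a : ℤ) - ((φ + ψ).denom.rootMultiplicity a : ℤ)
    omega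

theorem ordAt_C_mul {c : k} (hc : c ≠ 0) {φ : RatFunc k} (hφ : φ ≠ 0) (x : OnePoint k) :
    ordAt (RatFunc.C c * φ) x = ordAt φ x := by
  have hC : (RatFunc.C c : RatFunc k) ≠ 0 := by simpa using hc
  induction x with
  | infty =>
    change -(RatFunc.C c * φ).intDegree = -φ.intDegree
    rw [RatFunc.intDegree_mul hC hφ, RatFunc.intDegree_C, zero_add]
  | coe a =>
    have hs := RatFunc.num_ne_zero (mul_ne_zero hC hφ)
    have hn := RatFunc.num_ne_zero hφ
    have hd := RatFunc.denom_ne_zero φ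
    have key := RatFunc.num_denom_mul (RatFunc.C c) φ
    rw [RatFunc.denom_C, RatFunc.num_C, one_mul] at key
    have hl := mul_ne_zero hs hd
    have hr := hl
    rw [key] at hr
    have key2 := congrArg (Polynomial.rootMultiplicity a) key
    rw [Polynomial.rootMultiplicity_mul hl, Polynomial.rootMultiplicity_mul hr,
      Polynomial.rootMultiplicity_mul (left_ne_zero_of_mul hr), Polynomial.rootMultiplicity_C,
      zero_add] at key2
    change ((RatFunc.C c * φ).num.rootMultiplicity a : ℤ) -
      ((RatFunc.C c * φ).denom.rootMultiplicity a : ℤ) =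
      (φ.num.rootMultiplicity a : ℤ) - (φ.denom.rootMultiplicity a : ℤ)
    omega

/-- The space `L(D)` of rational functions `φ` on the projective line which are zero or satisfy
`div φ + D ≥ 0`. -/
def sections (D : OnePoint k →₀ ℤ) : Submodule k (RatFunc k) where
  carrier := {φ | φ = 0 ∨ ∀ x, 0 ≤ ordAt φ x + D x}
  zero_mem' := Or.inl rfl
  add_mem' := by
    intro φ ψ hφ hψ
    by_cases h0 : φ = 0
    · subst h0; simpa using hψ
    by_cases h1 : ψ = 0
    · subst h1; simpa using hφ
    by_cases h2 : φ + ψ = 0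
    · exact Or.inl h2
    refine Or.inr fun x => ?_
    have h3 := hφ.resolve_left h0 x
    have h4 := hψ.resolve_left h1 x
    have h5 := ordAt_add_ge h0 h1 h2 x
    omega
  smul_mem' := by
    intro c φ hφ
    by_cases hc : c = 0
    · subst hc; exact Or.inl (zero_smul _ _)
    by_cases h0 : φ = 0
    · subst h0; exact Or.inl (smul_zero _)
    refine Or.inr fun x => ?_
    rw [RatFunc.smul_eq_C_mul, ordAt_C_mul hc h0]
    exact hφ.resolve_left h0 x

end ProjLine

/-! ## Metric graphs and their rational functions -/

/-- A metric graph given by a model with vertices `V` and edges `A`: every edge `a` is a segment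
`[0, length a]`, glued at `0` to the vertex `source a` and at `length a` to `target a`.
The orientation of the edges is auxiliary. -/
structure MetricGraph (V A : Type*) where
  source : A → V
  target : A → V
  length : A → ℝ
  length_pos : ∀ a, 0 < length a

namespace MetricGraph

variable {V A : Type*}

/-- The two ends of an edge: `false` is the end at its source, `true` the end at its target. -/
def endpoint (Γ : MetricGraph V A) (a : A) : Bool → V
  | false => Γ.source a
  | true => Γ.target a

/-- A rational function on a metric graph: a continuous piecewise affine function with integer
slopes. `onEdge a t` is its value at the point `t` of the segment `[0, length a]`. The integers
`slopeFwd a t` and `slopeBwd a t` are its outgoing slopes at this point in the directions of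
increasing and of decreasing `t`; they are determined by the function (wherever the direction
exists). As `[0, length a]` is compact, the two local conditions say exactly that the function is
continuous on it and affine with integer slopes on finitely many pieces. -/
structure PLFunction (Γ : MetricGraph V A) where
  atVertex : V → ℝ
  onEdge : A → ℝ → ℝ
  onEdge_zero : ∀ a, onEdge a 0 = atVertex (Γ.source a)
  onEdge_length : ∀ a, onEdge a (Γ.length a) = atVertex (Γ.target a)
  slopeFwd : A → ℝ → ℤ
  slopeBwd : A → ℝ → ℤ
  slopeFwd_spec : ∀ a t, 0 ≤ t → t < Γ.length a →
    ∃ ε > 0, ∀ s, t ≤ s → s ≤ t + ε → onEdge a s = onEdge a t + slopeFwd a t * (s - t)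
  slopeBwd_spec : ∀ a t, 0 < t → t ≤ Γ.length a →
    ∃ ε > 0, ∀ s, t - ε ≤ s → s ≤ t → onEdge a s = onEdge a t + slopeBwd a t * (t - s)

/-- The outgoing slope of a rational function at an end of an edge, along this edge. -/
def PLFunction.endSlope {Γ : MetricGraph V A} (g : Γ.PLFunction) (a : A) : Bool → ℤ
  | false => g.slopeFwd a 0
  | true => g.slopeBwd a (Γ.length a)

end MetricGraph

/-! ## Metrized complexes with rational components -/

/-- A lift of the metric graph `Γ` to a metrized complex over `k` all of whose components are
rational: for every vertex `v` a copy `C_v` of the projective line over `k`, and for every end of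
an edge at `v` a point (the node) of `C_v`, distinct ends at `v` having distinct nodes. -/
structure RationalMetrizedComplex (k : Type*) [Field k] {V A : Type*} (Γ : MetricGraph V A) where
  node : A → Bool → OnePoint k
  node_injective : ∀ a b a' b', Γ.endpoint a b = Γ.endpoint a' b' → node a b = node a' b' →
    a = a' ∧ b = b'

namespace RationalMetrizedComplex

variable {k : Type*} [Field k] {V A : Type*} {Γ : MetricGraph V A}

/-- The points of (the geometric realization of) a metrized complex: the points of the curves
`C_v`, and the points in the interior of the edges. (The ends of the edges are glued to the
nodes, which are points of the curves.) -/
inductive Point (C : RationalMetrizedComplex k Γ) where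
  | onCurve (v : V) (x : OnePoint k) : C.Point
  | onEdge (a : A) (t : ℝ) (ht : t ∈ Set.Ioo 0 (Γ.length a)) : C.Point

/-- Divisors on a metrized complex: finite formal integral sums of points. -/
abbrev Divisor (C : RationalMetrizedComplex k Γ) := C.Point →₀ ℤ

/-- The degree of a divisor. -/
def degree {C : RationalMetrizedComplex k Γ} (D : C.Divisor) : ℤ := D.sum fun _ n => n

/-- A (nonzero) rational function on a metrized complex: a rational function on `Γ` together with
a nonzero rational function on each curve `C_v`. -/
structure RationalFunction (C : RationalMetrizedComplex k Γ) where
  onGraph : Γ.PLFunction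
  onCurve : V → RatFunc k
  onCurve_ne_zero : ∀ v, onCurve v ≠ 0

open Classical in
/-- The coefficient of the divisor `div 𝔣` of a rational function at a point. In the interior of
an edge it is minus the sum of the outgoing slopes. At a point `x` of `C_v` it is the order of
vanishing of `f_v`, from which, if `x` is the node of an edge, the outgoing slope along that edge
is subtracted. -/
def RationalFunction.ord [Fintype A] {C : RationalMetrizedComplex k Γ} (f : C.RationalFunction) :
    C.Point → ℤ
  | .onCurve v x => ProjLine.ordAt (f.onCurve v) x -
      ∑ h : A × Bool, if Γ.endpoint h.1 h.2 = v ∧ C.node h.1 h.2 = x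
        then f.onGraph.endSlope h.1 h.2 else 0
  | .onEdge a t _ => -(f.onGraph.slopeFwd a t + f.onGraph.slopeBwd a t)

/-- The rank of `D` restricted to `H = (H_v)` is at least `r`: for every effective divisor `E` of
degree `r` there is a rational function `𝔣` with `f_v ∈ H_v` for all `v` such that
`D - E + div 𝔣` is effective. -/
def RestrictedRankGE [Fintype A] (C : RationalMetrizedComplex k Γ) (D : C.Divisor)
    (H : V → Submodule k (RatFunc k)) (r : ℕ) : Prop :=
  ∀ E : C.Divisor, 0 ≤ E → degree E = r →
    ∃ f : C.RationalFunction, (∀ v, f.onCurve v ∈ H v) ∧ ∀ P, 0 ≤ D P - E P + f.ord P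

/-- The pair `(D, H)` is (represents) a limit `g^r_d`: the divisor `D` has degree `d`, every `H_v`
is a space of rational functions on `C_v` of dimension `r + 1`, and the rank of `D` restricted to
`H` is equal to `r`. -/
structure IsLimitLinearSeries [Fintype A] (C : RationalMetrizedComplex k Γ) (r d : ℕ)
    (D : C.Divisor) (H : V → Submodule k (RatFunc k)) : Prop where
  degree_eq : degree D = d
  finrank_eq : ∀ v, Module.finrank k (H v) = r + 1
  rank_eq : IsGreatest {s : ℕ | C.RestrictedRankGE D H s} r

end RationalMetrizedComplex

/-! ## Rank 3 simple matroids, their Levi graphs and divisors -/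

/-- A rank 3 simple matroid on a finite set of elements, given by its rank 2 flats: these are sets
of at least two elements, any two elements are contained in exactly one of them, and there are at
least two of them. -/
structure RankThreeSimpleMatroid (α : Type*) [Fintype α] where
  flats : Finset (Finset α)
  two_le_card : ∀ f ∈ flats, 2 ≤ f.card
  existsUnique_flat : ∀ a b : α, a ≠ b → ∃! f, f ∈ flats ∧ a ∈ f ∧ b ∈ f
  two_le_card_flats : 2 ≤ flats.card

namespace RankThreeSimpleMatroid

variable {α : Type*} [Fintype α]

/-- The type of (rank 2) flats. -/
abbrev Flat (M : RankThreeSimpleMatroid α) := {f : Finset α // f ∈ M.flats}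

/-- The type of complete flags: pairs of an element and a flat which contains it. -/
abbrev Flag (M : RankThreeSimpleMatroid α) := {p : α × M.Flat // p.1 ∈ p.2.1}

instance (M : RankThreeSimpleMatroid α) : Fintype M.Flag := Fintype.ofFinite _

/-- The Levi graph: its vertices are the elements and the flats, its edges are the complete flags,
and all edges have length one. -/
def leviGraph (M : RankThreeSimpleMatroid α) : MetricGraph (α ⊕ M.Flat) M.Flag where
  source p := Sum.inl p.1.1
  target p := Sum.inr p.1.2
  length _ := 1
  length_pos _ := one_pos

variable {k : Type*} [Field k] {M : RankThreeSimpleMatroid α}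

/-- The lift of the matroid divisor (the sum of the vertices of the Levi graph corresponding to
elements) to a metrized complex which is given by the choice of a point `x e` on the curve `C_e`
for every element `e`. -/
def liftDivisor (C : RationalMetrizedComplex k M.leviGraph) (x : α → OnePoint k) : C.Divisor :=
  ∑ e : α, Finsupp.single (RationalMetrizedComplex.Point.onCurve (Sum.inl e) (x e)) 1

/-- For a lift of the matroid divisor given by points `x e`, for flags `(p₁ f, f)` and `(p₂ f, f)`
for every flat `f`, and flags `(e, q e)` for every element `e`, the following spaces of rational
functions: on `C_f`, those with at worst simple poles at the nodes of the edges from `f` to `p₁ f`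
and `p₂ f`; on `C_e`, those with poles bounded by the sum of `x e` and the node of the edge from
`e` to `q e`. -/
def explicitSpaces (C : RationalMetrizedComplex k M.leviGraph) (x : α → OnePoint k)
    (p₁ p₂ : M.Flat → α) (hp₁ : ∀ f, p₁ f ∈ f.1) (hp₂ : ∀ f, p₂ f ∈ f.1)
    (q : α → M.Flat) (hq : ∀ e, e ∈ (q e).1) : α ⊕ M.Flat → Submodule k (RatFunc k)
  | Sum.inl e => ProjLine.sections
      (Finsupp.single (x e) 1 + Finsupp.single (C.node ⟨(e, q e), hq e⟩ false) 1)
  | Sum.inr f => ProjLine.sections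
      (Finsupp.single (C.node ⟨(p₁ f, f), hp₁ f⟩ true) 1 +
        Finsupp.single (C.node ⟨(p₂ f, f), hp₂ f⟩ true) 1)

end RankThreeSimpleMatroid

end

/-! Lower bound on the rank: any two points P, Q must be subtractable from the lift. The functions
used on the graph restrict to each edge as a minimum of `a + t`, `b + 1 - t` and a cap `c`. They are
concave, so their divisor is effective inside edges, and a point there is absorbed by a kink.

On the curves the problem becomes a count. On the projective line every effective divisor of degree
two is `div φ` plus the two prescribed poles for some `φ`. So a suitable section exists on a curve
once a certain integer function is bounded by an effective divisor of degree two. On `C_e` this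
function is `q_e` plus the outgoing slopes at the nodes plus those of P, Q on `C_e` (the pole `x_e`
is paid for by the divisor). On `C_f` it has `p_{f,1} + p_{f,2}` in place of `q_e`. Hence an element
can afford one slope 1, or one point if no slope is positive, or both points if all slopes are -1. A
flat with nonpositive slopes has nothing to spare, but slopes -1 in all directions cancel both poles
and free two units. These may go to P and Q or to one exceptional slope 1, which costs two.

Two families of functions suffice: plateaus around one flat or two disjoint flats, and stars around
the flats through an element `w`. The matroid axiom enters for stars: every other element lies on
exactly one flat through `w`, so it sees only one rising edge, which it can afford. The family and
its heights depend on the position of P and Q.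

Upper bound: on the curve of a flat the divisor has no points, and a nonzero section of a divisor of
degree two cannot vanish at three points away from the nodes. -/

namespace ProjLine

variable {k : Type*} [Field k]

/-! ### Orders and sections of divisors `P + Q` on the projective line -/

theorem ordAt_mul {φ ψ : RatFunc k} (hφ : φ ≠ 0) (hψ : ψ ≠ 0) (x : OnePoint k) :
    ordAt (φ * ψ) x = ordAt φ x + ordAt ψ x := by
  induction x with
  | infty =>
    change -(φ * ψ).intDegree = -φ.intDegree + -ψ.intDegree
    rw [RatFunc.intDegree_mul hφ hψ, neg_add]
  | coe a =>
    have hn := RatFunc.num_ne_zero hφ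
    have hm := RatFunc.num_ne_zero hψ
    have hs := RatFunc.num_ne_zero (mul_ne_zero hφ hψ)
    have hd := RatFunc.denom_ne_zero φ
    have he := RatFunc.denom_ne_zero ψ
    have ht := RatFunc.denom_ne_zero (φ * ψ)
    have key := congrArg (Polynomial.rootMultiplicity a) (RatFunc.num_denom_mul φ ψ)
    rw [Polynomial.rootMultiplicity_mul (mul_ne_zero hs (mul_ne_zero hd he)),
      Polynomial.rootMultiplicity_mul (mul_ne_zero hd he),
      Polynomial.rootMultiplicity_mul (mul_ne_zero (mul_ne_zero hn hm) ht),
      Polynomial.rootMultiplicity_mul (mul_ne_zero hn hm)] at key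
    change ((φ * ψ).num.rootMultiplicity a : ℤ) - ((φ * ψ).denom.rootMultiplicity a : ℤ) =
      ((φ.num.rootMultiplicity a : ℤ) - (φ.denom.rootMultiplicity a : ℤ)) +
      ((ψ.num.rootMultiplicity a : ℤ) - (ψ.denom.rootMultiplicity a : ℤ))
    omega

theorem ordAt_one (x : OnePoint k) : ordAt (1 : RatFunc k) x = 0 := by
  have h := ordAt_mul (one_ne_zero (α := RatFunc k)) one_ne_zero x
  rw [mul_one] at h
  omega

theorem ordAt_inv {φ : RatFunc k} (hφ : φ ≠ 0) (x : OnePoint k) :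
    ordAt φ⁻¹ x = -ordAt φ x := by
  have h := ordAt_mul hφ (inv_ne_zero hφ) x
  rw [mul_inv_cancel₀ hφ, ordAt_one] at h
  omega

theorem ordAt_algebraMap_coe (p : Polynomial k) (a : k) :
    ordAt (algebraMap (Polynomial k) (RatFunc k) p) (a : OnePoint k) = p.rootMultiplicity a := by
  change ((algebraMap (Polynomial k) (RatFunc k) p).num.rootMultiplicity a : ℤ) -
    ((algebraMap (Polynomial k) (RatFunc k) p).denom.rootMultiplicity a : ℤ) = _
  rw [RatFunc.num_algebraMap, RatFunc.denom_algebraMap, ← Polynomial.C_1,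
    Polynomial.rootMultiplicity_C]
  simp

theorem ordAt_algebraMap_infty (p : Polynomial k) :
    ordAt (algebraMap (Polynomial k) (RatFunc k) p) OnePoint.infty = -(p.natDegree : ℤ) := by
  change -(algebraMap (Polynomial k) (RatFunc k) p).intDegree = _
  rw [RatFunc.intDegree_polynomial]

/-- A linear form on the projective line which vanishes at the given point. -/
noncomputable def linearForm : OnePoint k → RatFunc k
  | OnePoint.some a => algebraMap (Polynomial k) (RatFunc k) (Polynomial.X - Polynomial.C a)
  | OnePoint.infty => 1

theorem linearForm_ne_zero (y : OnePoint k) : linearForm y ≠ 0 := by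
  induction y with
  | infty => exact one_ne_zero
  | coe a => exact RatFunc.algebraMap_ne_zero (Polynomial.X_sub_C_ne_zero a)

/-- The form is normalized by its pole at infinity; for `y = ∞` zero and pole cancel, which agrees
with the constant 1. The normalizations cancel in any quotient of products with equally many
factors. -/
theorem ordAt_linearForm (y x : OnePoint k) : ordAt (linearForm y) x =
    Finsupp.single y (1 : ℤ) x - Finsupp.single OnePoint.infty (1 : ℤ) x := by
  classical
  induction y with
  | infty => exact (ordAt_one x).trans (sub_self _).symm
  | coe a =>
    change ordAt (algebraMap (Polynomial k) (RatFunc k) (Polynomial.X - Polynomial.C a)) x = _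
    induction x with
    | infty =>
      rw [ordAt_algebraMap_infty, Polynomial.natDegree_X_sub_C]
      simp
    | coe b =>
      rw [ordAt_algebraMap_coe, Polynomial.rootMultiplicity_X_sub_C]
      simp [Finsupp.single_apply, eq_comm]

/-- A nonzero rational function with given divisor of the form `a + b - P - Q`. -/
theorem exists_ordAt_eq (a b P Q : OnePoint k) : ∃ φ : RatFunc k, φ ≠ 0 ∧
    ∀ x, ordAt φ x + (Finsupp.single P (1 : ℤ) x + Finsupp.single Q (1 : ℤ) x) =
      Finsupp.single a (1 : ℤ) x + Finsupp.single b (1 : ℤ) x := by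
  have ha := linearForm_ne_zero a
  have hb := linearForm_ne_zero b
  have hP := linearForm_ne_zero P
  have hQ := linearForm_ne_zero Q
  refine ⟨linearForm a * linearForm b * (linearForm P * linearForm Q)⁻¹,
    mul_ne_zero (mul_ne_zero ha hb) (inv_ne_zero (mul_ne_zero hP hQ)), fun x => ?_⟩
  rw [ordAt_mul (mul_ne_zero ha hb) (inv_ne_zero (mul_ne_zero hP hQ)),
    ordAt_inv (mul_ne_zero hP hQ), ordAt_mul ha hb, ordAt_mul hP hQ]
  simp only [ordAt_linearForm]
  ring

/-- A rational function over an algebraically closed field without poles in the affine line is a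
polynomial. -/
theorem exists_polynomial_of_ordAt_nonneg [IsAlgClosed k] {φ : RatFunc k}
    (h : ∀ a : k, 0 ≤ ordAt φ (a : OnePoint k)) :
    ∃ p : Polynomial k, algebraMap (Polynomial k) (RatFunc k) p = φ := by
  have hd : φ.denom = 1 := by
    refine Polynomial.eq_one_of_monic_natDegree_zero φ.monic_denom ?_
    by_contra hne
    obtain ⟨a, ha⟩ := IsAlgClosed.exists_root φ.denom
      fun hdeg => hne (Polynomial.natDegree_eq_of_degree_eq_some hdeg)
    have hpos := (Polynomial.rootMultiplicity_pos φ.denom_ne_zero).2 ha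
    have hnum : φ.num.rootMultiplicity a = 0 := by
      refine Polynomial.rootMultiplicity_eq_zero fun hr => ?_
      obtain ⟨u, v, huv⟩ := φ.isCoprime_num_denom
      have := congrArg (Polynomial.eval a) huv
      rw [Polynomial.eval_add, Polynomial.eval_mul, Polynomial.eval_mul, hr.eq_zero, ha.eq_zero] at this
      simp at this
    have := h a
    change 0 ≤ (φ.num.rootMultiplicity a : ℤ) - (φ.denom.rootMultiplicity a : ℤ) at this
    omega
  refine ⟨φ.num, ?_⟩
  conv_rhs => rw [← RatFunc.num_div_denom φ]
  rw [hd, map_one, div_one]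

/-- Multiplying by the linear forms of `P` and `Q` clears all finite poles and leaves a pole of
order at most two at infinity. The product can only gain zeros at finite points, whence the
comparison of orders. -/
theorem exists_polynomial_of_mem_sections [IsAlgClosed k] {P Q : OnePoint k} {φ : RatFunc k}
    (hφ : φ ≠ 0) (h : φ ∈ sections (Finsupp.single P 1 + Finsupp.single Q 1)) :
    ∃ p : Polynomial k, p ≠ 0 ∧ p.natDegree ≤ 2 ∧
      algebraMap (Polynomial k) (RatFunc k) p = φ * (linearForm P * linearForm Q) ∧
      ∀ a : k, ordAt φ (a : OnePoint k) ≤ p.rootMultiplicity a := by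
  have hP := linearForm_ne_zero P
  have hQ := linearForm_ne_zero Q
  have h' : ∀ x, 0 ≤ ordAt φ x + (Finsupp.single P (1 : ℤ) x + Finsupp.single Q (1 : ℤ) x) := by
    have h'' := Or.resolve_left h hφ
    simpa only [Finsupp.add_apply] using h''
  have hord : ∀ x, ordAt (φ * (linearForm P * linearForm Q)) x = ordAt φ x +
      (Finsupp.single P (1 : ℤ) x + Finsupp.single Q (1 : ℤ) x) -
        2 * Finsupp.single OnePoint.infty (1 : ℤ) x := by
    intro x
    rw [ordAt_mul hφ (mul_ne_zero hP hQ), ordAt_mul hP hQ, ordAt_linearForm, ordAt_linearForm]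
    ring
  have hfin : ∀ a : k, Finsupp.single OnePoint.infty (1 : ℤ) (a : OnePoint k) = 0 := by
    intro a
    exact Finsupp.single_eq_of_ne (OnePoint.coe_ne_infty a)
  obtain ⟨p, hp⟩ := exists_polynomial_of_ordAt_nonneg (φ := φ * (linearForm P * linearForm Q))
    (fun a => by rw [hord, hfin]; have := h' a; omega)
  have hp0 : p ≠ 0 := by
    rintro rfl
    rw [map_zero] at hp
    exact mul_ne_zero hφ (mul_ne_zero hP hQ) hp.symm
  refine ⟨p, hp0, ?_, hp, fun a => ?_⟩
  · have h1 := hord OnePoint.infty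
    have h2 := h' OnePoint.infty
    rw [← hp, ordAt_algebraMap_infty, Finsupp.single_eq_same] at h1
    omega
  · have h1 := hord a
    rw [← hp, ordAt_algebraMap_coe, hfin] at h1
    have : ∀ y z : OnePoint k, 0 ≤ Finsupp.single y (1 : ℤ) z := by
      classical
      intro y z
      rw [Finsupp.single_apply]
      split_ifs <;> simp
    have h2 := this P a
    have h3 := this Q a
    omega

/-- A nonzero section of a divisor `P + Q` has at most two zeros. -/
theorem eq_zero_of_ordAt_pos [IsAlgClosed k] {P Q : OnePoint k} {φ : RatFunc k}
    (h : φ ∈ sections (Finsupp.single P 1 + Finsupp.single Q 1)) (t : Finset k) (ht : 2 < t.card)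
    (hpos : ∀ a ∈ t, 0 < ordAt φ (a : OnePoint k)) : φ = 0 := by
  by_contra hφ
  obtain ⟨p, hp0, hp2, -, hp⟩ := exists_polynomial_of_mem_sections hφ h
  refine hp0 (Polynomial.eq_zero_of_natDegree_lt_card_of_eval_eq_zero' p t (fun a ha => ?_)
    (hp2.trans_lt ht))
  have := (hpos a ha).trans_le (hp a)
  exact (Polynomial.rootMultiplicity_pos hp0).1 (by omega)

/-- Multiplication by the inverse of the two linear forms identifies polynomials of degree less than
3 with the sections. -/
theorem finrank_sections [IsAlgClosed k] (P Q : OnePoint k) :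
    Module.finrank k (sections (Finsupp.single P 1 + Finsupp.single Q 1)) = 3 := by
  have hP := linearForm_ne_zero P
  have hQ := linearForm_ne_zero Q
  have hψ := mul_ne_zero hP hQ
  set ψ := linearForm P * linearForm Q with hψdef
  let F : Polynomial k →ₗ[k] RatFunc k :=
    (LinearMap.mulRight k ψ⁻¹).comp (Algebra.linearMap (Polynomial k) (RatFunc k)|>.restrictScalars k)
  have hF : ∀ p, F p = algebraMap (Polynomial k) (RatFunc k) p * ψ⁻¹ := fun p => rfl
  have hinj : Function.Injective F := by
    intro p q hpq
    rw [hF, hF] at hpq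
    exact RatFunc.algebraMap_injective k (mul_right_cancel₀ (inv_ne_zero hψ) hpq)
  have hrange : sections (Finsupp.single P 1 + Finsupp.single Q 1) =
      (Polynomial.degreeLT k 3).map F := by
    ext φ
    constructor
    · intro h
      by_cases hφ : φ = 0
      · subst hφ; exact zero_mem _
      obtain ⟨p, hp0, hp2, hp, -⟩ := exists_polynomial_of_mem_sections hφ h
      refine ⟨p, ?_, ?_⟩
      · rw [SetLike.mem_coe, Polynomial.mem_degreeLT]
        exact (Polynomial.natDegree_lt_iff_degree_lt hp0).1 (by omega)
      · rw [hF, hp, mul_assoc, mul_inv_cancel₀ hψ, mul_one]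
    · rintro ⟨p, hp, rfl⟩
      by_cases hp0 : p = 0
      · subst hp0; rw [map_zero]; exact zero_mem _
      rw [SetLike.mem_coe, Polynomial.mem_degreeLT] at hp
      have hp' : p.natDegree < 3 := (Polynomial.natDegree_lt_iff_degree_lt hp0).2 hp
      refine Or.inr fun x => ?_
      rw [hF, ordAt_mul (RatFunc.algebraMap_ne_zero hp0) (inv_ne_zero hψ), ordAt_inv hψ, hψdef,
        ordAt_mul hP hQ, ordAt_linearForm, ordAt_linearForm, Finsupp.add_apply]
      induction x with
      | infty =>
        rw [ordAt_algebraMap_infty, Finsupp.single_eq_same]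
        omega
      | coe a =>
        rw [ordAt_algebraMap_coe, Finsupp.single_eq_of_ne (OnePoint.coe_ne_infty a)]
        omega
  rw [hrange, ← (Submodule.equivMapOfInjective F hinj _).finrank_eq,
    (Polynomial.degreeLTEquiv k 3).finrank_eq, Module.finrank_fin_fun]

end ProjLine

/-! ### Functions bounded by effective divisors of given degree -/

namespace ProjLine

section Dominated

variable {X : Type*}

/-- An integer-valued function is dominated by an effective divisor of degree at most `n`. -/
def Dominated (F : X → ℤ) (n : ℕ) : Prop :=
  ∃ s : Multiset (X), s.card ≤ n ∧
    ∀ x, F x ≤ (s.map fun a => Finsupp.single a (1 : ℤ) x).sum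

theorem Dominated.add {F G : X → ℤ} {m n : ℕ} (hF : Dominated F m)
    (hG : Dominated G n) : Dominated (fun x => F x + G x) (m + n) := by
  obtain ⟨s, hs, hs'⟩ := hF
  obtain ⟨t, ht, ht'⟩ := hG
  refine ⟨s + t, by rw [Multiset.card_add]; omega, fun x => ?_⟩
  rw [Multiset.map_add, Multiset.sum_add]
  exact add_le_add (hs' x) (ht' x)

theorem Dominated.mono {F G : X → ℤ} {m n : ℕ} (hF : Dominated F m)
    (h : ∀ x, G x ≤ F x) (hmn : m ≤ n) : Dominated G n := by
  obtain ⟨s, hs, hs'⟩ := hF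
  exact ⟨s, hs.trans hmn, fun x => (h x).trans (hs' x)⟩

theorem dominated_zero : Dominated (fun _ : X => 0) 0 :=
  ⟨0, by simp, by simp⟩

theorem dominated_single (a : X) :
    Dominated (fun x => Finsupp.single a (1 : ℤ) x) 1 :=
  ⟨{a}, by simp, by simp⟩

end Dominated

/-- Any two effective divisors of degree two on the projective line are linearly equivalent: once
`F` is bounded by `a + b`, the function with divisor `a + b - P - Q` works. This turns the search
for sections into a count of degrees. -/
theorem Dominated.exists_section {k : Type*} [Field k] {F : OnePoint k → ℤ} (hF : Dominated F 2) (P Q : OnePoint k) :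
    ∃ φ : RatFunc k, φ ≠ 0 ∧ φ ∈ sections (Finsupp.single P 1 + Finsupp.single Q 1) ∧
      ∀ x, F x ≤ ordAt φ x + (Finsupp.single P (1 : ℤ) x + Finsupp.single Q (1 : ℤ) x) := by
  classical
  have hnn : ∀ y z : OnePoint k, 0 ≤ Finsupp.single y (1 : ℤ) z := by
    intro y z
    rw [Finsupp.single_apply]
    split_ifs <;> simp
  have key : ∃ a b : OnePoint k, ∀ x,
      F x ≤ Finsupp.single a (1 : ℤ) x + Finsupp.single b (1 : ℤ) x := by
    obtain ⟨s, hs, hs'⟩ := hF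
    have h3 : s.card = 0 ∨ s.card = 1 ∨ s.card = 2 := by omega
    -- Fewer than two points are padded with copies of `P`, which only raises the bound.
    rcases h3 with h | h | h
    · rw [Multiset.card_eq_zero] at h
      subst h
      refine ⟨P, P, fun x => ?_⟩
      have := hs' x
      have h4 := hnn P x
      simp only [Multiset.map_zero, Multiset.sum_zero] at this
      omega
    · obtain ⟨a, rfl⟩ := Multiset.card_eq_one.1 h
      refine ⟨a, P, fun x => ?_⟩
      have := hs' x
      have h4 := hnn P x
      simp only [Multiset.map_singleton, Multiset.sum_singleton] at this
      omega
    · obtain ⟨a, b, rfl⟩ := Multiset.card_eq_two.1 h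
      refine ⟨a, b, fun x => ?_⟩
      have := hs' x
      simpa using this
  obtain ⟨a, b, hab⟩ := key
  obtain ⟨φ, hφ, hφ'⟩ := exists_ordAt_eq a b P Q
  refine ⟨φ, hφ, Or.inr fun x => ?_, fun x => (hab x).trans_eq (hφ' x).symm⟩
  rw [Finsupp.add_apply, hφ']
  exact add_nonneg (hnn a x) (hnn b x)

end ProjLine

/-! ### Slopes at the nodes of a curve -/

namespace RationalMetrizedComplex

variable {k : Type*} [Field k] {V A : Type*} [Fintype A] {Γ : MetricGraph V A}

open Classical in
/-- The sum of the outgoing slopes at `v` along the edges with node `x`. -/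
noncomputable def nodeSlope (C : RationalMetrizedComplex k Γ) (g : Γ.PLFunction) (v : V)
    (x : OnePoint k) : ℤ :=
  ∑ h : A × Bool, if Γ.endpoint h.1 h.2 = v ∧ C.node h.1 h.2 = x then g.endSlope h.1 h.2 else 0

/-- A bound for the slopes at all nodes of a curve, as a function of the node. -/
theorem nodeSlope_le (C : RationalMetrizedComplex k Γ) (g : Γ.PLFunction) (v : V)
    (T : OnePoint k → ℤ)
    (hT : ∀ a b, Γ.endpoint a b = v → g.endSlope a b ≤ T (C.node a b))
    (h0 : ∀ x, (∀ a b, Γ.endpoint a b = v → C.node a b ≠ x) → 0 ≤ T x) (x : OnePoint k) :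
    C.nodeSlope g v x ≤ T x := by
  classical
  unfold nodeSlope
  by_cases hx : ∃ h : A × Bool, Γ.endpoint h.1 h.2 = v ∧ C.node h.1 h.2 = x
  · obtain ⟨h, hv, rfl⟩ := hx
    rw [Finset.sum_eq_single h]
    · rw [if_pos ⟨hv, rfl⟩]
      exact hT _ _ hv
    · rintro h' - hne
      refine if_neg fun hh => hne ?_
      obtain ⟨h1, h2⟩ := C.node_injective _ _ _ _ (hh.1.trans hv.symm) hh.2
      exact Prod.ext h1 h2
    · exact fun hh => (hh (Finset.mem_univ _)).elim
  · rw [Finset.sum_eq_zero]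
    · exact h0 x fun a b hv hn => hx ⟨(a, b), hv, hn⟩
    · exact fun h _ => if_neg fun hh => hx ⟨h, hh⟩

theorem nodeSlope_eq_zero (C : RationalMetrizedComplex k Γ) (g : Γ.PLFunction) (v : V)
    (x : OnePoint k) (hx : ∀ a b, C.node a b ≠ x) : C.nodeSlope g v x = 0 :=
  Finset.sum_eq_zero fun _ _ => if_neg fun hh => hx _ _ hh.2

theorem RationalFunction.ord_onCurve {C : RationalMetrizedComplex k Γ} (f : C.RationalFunction)
    (v : V) (x : OnePoint k) :
    f.ord (.onCurve v x) = ProjLine.ordAt (f.onCurve v) x - C.nodeSlope f.onGraph v x :=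
  rfl

end RationalMetrizedComplex

namespace ConcaveProfile

/-! ### Concave profiles on the unit interval

For `a`, `b`, `c` with `|a - b| ≤ 1` and `max a b ≤ c` the function
`t ↦ min (min (a + t) (b + 1 - t)) c` is concave, with slopes in `{1, 0, -1}` and with the value `a`
at `0` and `b` at `1`. -/

/-- The profile `t ↦ min (min (a + t) (b + 1 - t)) c`. -/
noncomputable def value (a b c t : ℝ) : ℝ := min (min (a + t) (b + 1 - t)) c

open Classical in
/-- The slope of a profile to the right. -/
noncomputable def slopeRight (a b c t : ℝ) : ℤ :=
  if a + t < c ∧ a + t < b + 1 - t then 1 else if c < b + 1 - t then 0 else -1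

open Classical in
/-- The outgoing slope of a profile to the left. -/
noncomputable def slopeLeft (a b c t : ℝ) : ℤ :=
  if b + 1 - t < c ∧ b + 1 - t < a + t then 1 else if c < a + t then 0 else -1

theorem slopeRight_spec (a b c t : ℝ) : ∃ ε > 0, ∀ s, t ≤ s → s ≤ t + ε →
    value a b c s = value a b c t + slopeRight a b c t * (s - t) := by
  unfold slopeRight value
  split_ifs with h1 h2
  · obtain ⟨h1, h1'⟩ := h1
    have hδ : 0 < min (c - (a + t)) ((b + 1 - t - (a + t)) / 2) :=
      lt_min (by linarith) (by linarith)
    refine ⟨_, hδ, fun s hs hs' => ?_⟩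
    have e1 := min_le_left (c - (a + t)) ((b + 1 - t - (a + t)) / 2)
    have e2 := min_le_right (c - (a + t)) ((b + 1 - t - (a + t)) / 2)
    rw [min_eq_left (a := a + s) (by linarith), min_eq_left (a := a + s) (by linarith),
      min_eq_left h1'.le, min_eq_left h1.le]
    push_cast
    ring
  · have h3 : c ≤ a + t := by
      by_contra hc
      exact h1 ⟨by linarith, by linarith⟩
    refine ⟨b + 1 - t - c, by linarith, fun s hs hs' => ?_⟩
    rw [min_eq_right (le_min h3 h2.le), min_eq_right (le_min (by linarith) (by linarith))]
    push_cast
    ring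
  · have h3 : b + 1 - t ≤ a + t := by
      by_contra hc
      exact h1 ⟨by linarith, by linarith⟩
    refine ⟨1, one_pos, fun s hs hs' => ?_⟩
    rw [min_eq_right h3, min_eq_left (a := b + 1 - t) (by linarith),
      min_eq_right (a := a + s) (by linarith), min_eq_left (a := b + 1 - s) (by linarith)]
    push_cast
    ring

theorem value_symm (a b c t : ℝ) : value a b c t = value b a c (1 - t) := by
  unfold value
  rw [min_comm (a + t)]
  congr 2 <;> ring

theorem slopeLeft_eq (a b c t : ℝ) : slopeLeft a b c t = slopeRight b a c (1 - t) := by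
  unfold slopeLeft slopeRight
  have h1 : b + (1 - t) = b + 1 - t := by ring
  have h2 : a + 1 - (1 - t) = a + t := by ring
  rw [h1, h2]

theorem slopeLeft_spec (a b c t : ℝ) : ∃ ε > 0, ∀ s, t - ε ≤ s → s ≤ t →
    value a b c s = value a b c t + slopeLeft a b c t * (t - s) := by
  obtain ⟨ε, hε, h⟩ := slopeRight_spec b a c (1 - t)
  refine ⟨ε, hε, fun s hs hs' => ?_⟩
  rw [value_symm, value_symm a b c t, slopeLeft_eq, h _ (by linarith) (by linarith)]
  ring

/-- Concavity of a minimum of affine functions. -/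
theorem chip_nonneg (a b c t : ℝ) : 0 ≤ -(slopeRight a b c t + slopeLeft a b c t) := by
  unfold slopeRight slopeLeft
  split_ifs <;> grind

/-- At `t` the cap meets the tent formed by the other two functions, so the slope drops there by at
least one. Later choices of the cap `c` serve to place such a kink at a given point. -/
theorem one_le_chip {a b c t : ℝ} (h : min (a + t) (b + 1 - t) = c) :
    1 ≤ -(slopeRight a b c t + slopeLeft a b c t) := by
  unfold slopeRight slopeLeft
  rcases min_choice (a + t) (b + 1 - t) with h' | h' <;>
    [have h2 := min_le_right (a + t) (b + 1 - t); have h2 := min_le_left (a + t) (b + 1 - t)] <;>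
    rw [h] at h' h2 <;> split_ifs <;> grind

/-- At an uncut apex of the tent the slope drops from 1 to -1. -/
theorem two_le_chip {a b c t : ℝ} (h : a + t = b + 1 - t) (h' : a + t ≤ c) :
    2 ≤ -(slopeRight a b c t + slopeLeft a b c t) := by
  unfold slopeRight slopeLeft
  split_ifs <;> grind

theorem slopeRight_le_one (a b c t : ℝ) : slopeRight a b c t ≤ 1 := by
  unfold slopeRight
  split_ifs <;> simp

theorem slopeRight_zero_nonpos {a b c : ℝ} (h : c ≤ a ∨ b + 1 ≤ a) : slopeRight a b c 0 ≤ 0 := by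
  unfold slopeRight
  rw [if_neg (fun hh => by rcases h with h | h <;> linarith [hh.1, hh.2])]
  split_ifs <;> simp

theorem slopeRight_zero_neg {a b c : ℝ} (h : b + 1 ≤ a) (h' : a ≤ c) :
    slopeRight a b c 0 ≤ -1 := by
  unfold slopeRight
  rw [if_neg (fun hh => by linarith [hh.1, hh.2]), if_neg (by linarith)]

theorem slopeLeft_le_one (a b c t : ℝ) : slopeLeft a b c t ≤ 1 := by
  rw [slopeLeft_eq]; exact slopeRight_le_one _ _ _ _

theorem slopeLeft_one_nonpos {a b c : ℝ} (h : c ≤ b ∨ a + 1 ≤ b) : slopeLeft a b c 1 ≤ 0 := by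
  rw [slopeLeft_eq, sub_self]; exact slopeRight_zero_nonpos h

theorem slopeLeft_one_neg {a b c : ℝ} (h : a + 1 ≤ b) (h' : b ≤ c) : slopeLeft a b c 1 ≤ -1 := by
  rw [slopeLeft_eq, sub_self]; exact slopeRight_zero_neg h h'

end ConcaveProfile

/-! ### Concave functions on the Levi graph and the degrees they cost on the curves -/

namespace RankThreeSimpleMatroid

variable {α : Type*} [Fintype α]

/-- Values at the vertices of the Levi graph, and a bound for the values on each edge, for which
the concave profiles on the edges fit together. -/
structure ConcaveData (M : RankThreeSimpleMatroid α) where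
  onElement : α → ℝ
  onFlat : M.Flat → ℝ
  level : M.Flag → ℝ
  element_le : ∀ p : M.Flag, onElement p.1.1 ≤ onFlat p.1.2 + 1
  flat_le : ∀ p : M.Flag, onFlat p.1.2 ≤ onElement p.1.1 + 1
  element_le_level : ∀ p : M.Flag, onElement p.1.1 ≤ level p
  flat_le_level : ∀ p : M.Flag, onFlat p.1.2 ≤ level p

variable {M : RankThreeSimpleMatroid α}

namespace ConcaveData

/-- The slope at the element of a flag, along the corresponding edge. -/
noncomputable def elementSlope (g : M.ConcaveData) (p : M.Flag) : ℤ :=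
  ConcaveProfile.slopeRight (g.onElement p.1.1) (g.onFlat p.1.2) (g.level p) 0

/-- The slope at the flat of a flag, along the corresponding edge. -/
noncomputable def flatSlope (g : M.ConcaveData) (p : M.Flag) : ℤ :=
  ConcaveProfile.slopeLeft (g.onElement p.1.1) (g.onFlat p.1.2) (g.level p) 1

/-- The coefficient of the divisor in the interior of an edge. -/
noncomputable def chip (g : M.ConcaveData) (p : M.Flag) (t : ℝ) : ℤ :=
  -(ConcaveProfile.slopeRight (g.onElement p.1.1) (g.onFlat p.1.2) (g.level p) t +
    ConcaveProfile.slopeLeft (g.onElement p.1.1) (g.onFlat p.1.2) (g.level p) t)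

/-- The piecewise affine function on the Levi graph with the given concave profiles. -/
noncomputable def toPLFunction (g : M.ConcaveData) : M.leviGraph.PLFunction where
  atVertex := Sum.elim g.onElement g.onFlat
  onEdge p := ConcaveProfile.value (g.onElement p.1.1) (g.onFlat p.1.2) (g.level p)
  onEdge_zero p := by
    change ConcaveProfile.value _ _ _ 0 = g.onElement p.1.1
    unfold ConcaveProfile.value
    rw [add_zero, sub_zero, min_eq_left (g.element_le p), min_eq_left (g.element_le_level p)]
  onEdge_length p := by
    change ConcaveProfile.value _ _ _ 1 = g.onFlat p.1.2
    unfold ConcaveProfile.value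
    rw [add_sub_cancel_right, min_eq_right (g.flat_le p), min_eq_left (g.flat_le_level p)]
  slopeFwd p := ConcaveProfile.slopeRight (g.onElement p.1.1) (g.onFlat p.1.2) (g.level p)
  slopeBwd p := ConcaveProfile.slopeLeft (g.onElement p.1.1) (g.onFlat p.1.2) (g.level p)
  slopeFwd_spec p t _ _ := ConcaveProfile.slopeRight_spec _ _ _ _
  slopeBwd_spec p t _ _ := ConcaveProfile.slopeLeft_spec _ _ _ _

variable {k : Type*} [Field k] (C : RationalMetrizedComplex k M.leviGraph)

theorem nodeSlope_inl_le (g : M.ConcaveData) (e : α) (T : OnePoint k → ℤ)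
    (hT : ∀ p : M.Flag, p.1.1 = e → g.elementSlope p ≤ T (C.node p false))
    (h0 : ∀ x, (∀ p : M.Flag, p.1.1 = e → C.node p false ≠ x) → 0 ≤ T x) (x : OnePoint k) :
    C.nodeSlope g.toPLFunction (Sum.inl e) x ≤ T x := by
  refine C.nodeSlope_le _ _ T (fun p b hp => ?_) (fun x hx => h0 x fun p hp =>
    hx p false (congrArg Sum.inl hp)) x
  cases b with
  | false => exact hT p (Sum.inl_injective hp)
  | true => exact (Sum.inr_ne_inl hp).elim

theorem nodeSlope_inr_le (g : M.ConcaveData) (f : M.Flat) (T : OnePoint k → ℤ)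
    (hT : ∀ p : M.Flag, p.1.2 = f → g.flatSlope p ≤ T (C.node p true))
    (h0 : ∀ x, (∀ p : M.Flag, p.1.2 = f → C.node p true ≠ x) → 0 ≤ T x) (x : OnePoint k) :
    C.nodeSlope g.toPLFunction (Sum.inr f) x ≤ T x := by
  refine C.nodeSlope_le _ _ T (fun p b hp => ?_) (fun x hx => h0 x fun p hp =>
    hx p true (congrArg Sum.inr hp)) x
  cases b with
  | true => exact hT p (Sum.inr_injective hp)
  | false => exact (Sum.inl_ne_inr hp).elim

theorem single_node_false {p p' : M.Flag} (h : p.1.1 = p'.1.1) :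
    (Finsupp.single (C.node p false) (1 : ℤ) (C.node p' false) = 1 ∧ p = p') ∨
      (Finsupp.single (C.node p false) (1 : ℤ) (C.node p' false) = 0 ∧ p ≠ p') := by
  by_cases hpp : p = p'
  · subst hpp
    exact Or.inl ⟨Finsupp.single_eq_same, rfl⟩
  · refine Or.inr ⟨Finsupp.single_eq_of_ne fun hn => hpp ?_, hpp⟩
    exact (C.node_injective p' false p false (congrArg Sum.inl h.symm) hn).1.symm

theorem single_node_true {p p' : M.Flag} (h : p.1.2 = p'.1.2) :
    (Finsupp.single (C.node p true) (1 : ℤ) (C.node p' true) = 1 ∧ p = p') ∨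
      (Finsupp.single (C.node p true) (1 : ℤ) (C.node p' true) = 0 ∧ p ≠ p') := by
  by_cases hpp : p = p'
  · subst hpp
    exact Or.inl ⟨Finsupp.single_eq_same, rfl⟩
  · refine Or.inr ⟨Finsupp.single_eq_of_ne fun hn => hpp ?_, hpp⟩
    exact (C.node_injective p' true p true (congrArg Sum.inr h.symm) hn).1.symm

open ProjLine

/-- The curve of an element absorbs one upward slope. -/
theorem dominated_inl (g : M.ConcaveData) (r p : M.Flag)
    (h : ∀ p' : M.Flag, p'.1.1 = r.1.1 → p' ≠ p → g.elementSlope p' ≤ 0) :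
    Dominated (fun x => Finsupp.single (C.node r false) (1 : ℤ) x +
      C.nodeSlope g.toPLFunction (Sum.inl r.1.1) x) 2 := by
  by_cases hp : p.1.1 = r.1.1
  · refine ((dominated_single (C.node r false)).add (dominated_single (C.node p false))).mono
      (fun x => add_le_add le_rfl ?_) le_rfl
    refine g.nodeSlope_inl_le C r.1.1 (fun x => Finsupp.single (C.node p false) (1 : ℤ) x)
      (fun p' hp' => ?_) (fun x hx => ?_) x
    · rcases single_node_false C (hp.trans hp'.symm) with ⟨h1, h2⟩ | ⟨h1, h2⟩ <;> rw [h1]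
      · exact ConcaveProfile.slopeRight_le_one _ _ _ _
      · exact h p' hp' h2.symm
    · rw [Finsupp.single_eq_of_ne (hx p hp).symm]
  · refine (dominated_single (C.node r false)).mono (fun x => ?_) one_le_two
    have := g.nodeSlope_inl_le C r.1.1 (fun _ => 0) (fun p' hp' => h p' hp' ?_)
      (fun _ _ => le_rfl) x
    · linarith
    · rintro rfl
      exact hp hp'

theorem dominated_inl_of_nonpos (g : M.ConcaveData) (r : M.Flag)
    (h : ∀ p' : M.Flag, p'.1.1 = r.1.1 → g.elementSlope p' ≤ 0) :
    Dominated (fun x => Finsupp.single (C.node r false) (1 : ℤ) x +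
      C.nodeSlope g.toPLFunction (Sum.inl r.1.1) x) 1 := by
  refine (dominated_single (C.node r false)).mono (fun x => ?_) le_rfl
  have := g.nodeSlope_inl_le C r.1.1 (fun _ => 0) h (fun _ _ => le_rfl) x
  linarith

/-- The slope -1 at the node of `r` cancels the prescribed pole there, so both units remain
available. -/
theorem dominated_inl_of_neg (g : M.ConcaveData) (r : M.Flag)
    (h : ∀ p' : M.Flag, p'.1.1 = r.1.1 → g.elementSlope p' ≤ -1) :
    Dominated (fun x => Finsupp.single (C.node r false) (1 : ℤ) x +
      C.nodeSlope g.toPLFunction (Sum.inl r.1.1) x) 0 := by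
  refine dominated_zero.mono (fun x => ?_) le_rfl
  have := g.nodeSlope_inl_le C r.1.1 (fun x => -Finsupp.single (C.node r false) (1 : ℤ) x)
    (fun p' hp' => ?_) (fun x hx => ?_) x
  · linarith
  · have := h p' hp'
    rcases single_node_false C hp'.symm with ⟨h1, h2⟩ | ⟨h1, h2⟩ <;> rw [h1] <;> linarith
  · rw [Finsupp.single_eq_of_ne (hx r rfl).symm, neg_zero]

variable {f : M.Flat} {p₁ p₂ : α}

/-- A flat absorbs nonpositive slopes. -/
theorem dominated_inr_of_nonpos (g : M.ConcaveData) (hp₁ : p₁ ∈ f.1) (hp₂ : p₂ ∈ f.1)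
    (h : ∀ p : M.Flag, p.1.2 = f → g.flatSlope p ≤ 0) :
    Dominated (fun x => Finsupp.single (C.node ⟨(p₁, f), hp₁⟩ true) (1 : ℤ) x +
      Finsupp.single (C.node ⟨(p₂, f), hp₂⟩ true) (1 : ℤ) x +
      C.nodeSlope g.toPLFunction (Sum.inr f) x) 2 := by
  refine ((dominated_single (C.node ⟨(p₁, f), hp₁⟩ true)).add
    (dominated_single (C.node ⟨(p₂, f), hp₂⟩ true))).mono (fun x => ?_) le_rfl
  have := g.nodeSlope_inr_le C f (fun _ => 0) h (fun _ _ => le_rfl) x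
  linarith

/-- If all slopes but the one in direction `w` are negative, the slope in direction `w` can be
absorbed. -/
theorem dominated_inr (g : M.ConcaveData) (hp₁ : p₁ ∈ f.1) (hp₂ : p₂ ∈ f.1)
    (hne : p₁ ≠ p₂) {w : α} (hw : w ∈ f.1) (n : ℕ)
    (h : ∀ p : M.Flag, p.1.2 = f → p.1.1 ≠ w → g.flatSlope p ≤ -1)
    (h' : g.flatSlope ⟨(w, f), hw⟩ + 1 ≤ n) :
    Dominated (fun x => Finsupp.single (C.node ⟨(p₁, f), hp₁⟩ true) (1 : ℤ) x +
      Finsupp.single (C.node ⟨(p₂, f), hp₂⟩ true) (1 : ℤ) x +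
      C.nodeSlope g.toPLFunction (Sum.inr f) x) n := by
  -- All cost is concentrated at the node of `w`: elsewhere a slope of at most -1 outweighs a
  -- possible pole. The `+ 1` in `h'` covers a pole at this node; there is at most one since `p₁ ≠
  -- p₂`.
  refine Dominated.mono (F := fun x => (n : ℤ) * Finsupp.single (C.node ⟨(w, f), hw⟩ true) 1 x)
    ⟨Multiset.replicate n (C.node ⟨(w, f), hw⟩ true), by simp, fun x => by simp⟩
    (fun x => ?_) le_rfl
  have := g.nodeSlope_inr_le C f
    (fun x => (n : ℤ) * Finsupp.single (C.node ⟨(w, f), hw⟩ true) 1 x -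
      (Finsupp.single (C.node ⟨(p₁, f), hp₁⟩ true) (1 : ℤ) x +
      Finsupp.single (C.node ⟨(p₂, f), hp₂⟩ true) (1 : ℤ) x))
    (fun p hp => ?_) (fun x hx => ?_) x
  · linarith
  · have hcases : g.flatSlope p + 1 ≤
        (n : ℤ) * Finsupp.single (C.node ⟨(w, f), hw⟩ true) 1 (C.node p true) := by
      rcases single_node_true C (p := ⟨(w, f), hw⟩) hp.symm with ⟨h1, rfl⟩ | ⟨h1, h2⟩ <;> rw [h1]
      · rw [mul_one]; exact h'
      · have := h p hp (fun hpw => h2 (Subtype.ext (Prod.ext hpw.symm hp.symm)))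
        linarith
    rcases single_node_true C (p := ⟨(p₁, f), hp₁⟩) hp.symm with ⟨h1, h2⟩ | ⟨h1, h2⟩ <;>
    rcases single_node_true C (p := ⟨(p₂, f), hp₂⟩) hp.symm with ⟨h3, h4⟩ | ⟨h3, h4⟩ <;>
    rw [h1, h3] <;> try linarith
    exact (hne (congrArg (fun q : M.Flag => q.1.1) (h2.trans h4.symm))).elim
  · rw [Finsupp.single_eq_of_ne (hx _ rfl).symm, Finsupp.single_eq_of_ne (hx _ rfl).symm,
      Finsupp.single_eq_of_ne (hx _ rfl).symm, mul_zero]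
    rfl

theorem dominated_inr_of_neg (g : M.ConcaveData) (hp₁ : p₁ ∈ f.1) (hp₂ : p₂ ∈ f.1)
    (hne : p₁ ≠ p₂) (h : ∀ p : M.Flag, p.1.2 = f → g.flatSlope p ≤ -1) :
    Dominated (fun x => Finsupp.single (C.node ⟨(p₁, f), hp₁⟩ true) (1 : ℤ) x +
      Finsupp.single (C.node ⟨(p₂, f), hp₂⟩ true) (1 : ℤ) x +
      C.nodeSlope g.toPLFunction (Sum.inr f) x) 0 :=
  g.dominated_inr C hp₁ hp₂ hne hp₁ 0 (fun p hp _ => h p hp)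
    (by have := h ⟨(p₁, f), hp₁⟩ rfl; push_cast; linarith)

end ConcaveData

end RankThreeSimpleMatroid

/-! ### Points and lifts of the matroid divisor on the curves -/

namespace RationalMetrizedComplex

variable {k : Type*} [Field k] {V A : Type*} {Γ : MetricGraph V A}
  {C : RationalMetrizedComplex k Γ}

open Classical in
/-- The number of times (zero or one) a point lies on the curve `C_v`. -/
noncomputable def Point.multiplicityOn (v : V) : C.Point → ℕ
  | .onCurve v' _ => if v' = v then 1 else 0
  | .onEdge _ _ _ => 0

theorem Point.multiplicityOn_le_one (v : V) (P : C.Point) : P.multiplicityOn v ≤ 1 := by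
  cases P with
  | onCurve v' y =>
    classical
    change (if v' = v then 1 else 0) ≤ 1
    split_ifs <;> simp
  | onEdge a t ht => exact zero_le_one

theorem Point.multiplicityOn_onCurve_of_ne {v v' : V} (h : v' ≠ v) (y : OnePoint k) :
    (Point.onCurve v' y : C.Point).multiplicityOn v = 0 :=
  if_neg h

theorem Point.dominated_single (v : V) (P : C.Point) :
    ProjLine.Dominated (fun y => (Finsupp.single P (1 : ℤ)) (Point.onCurve v y))
      (P.multiplicityOn v) := by
  cases P with
  | onCurve v' z =>
    by_cases hv : v' = v
    · subst hv
      refine (ProjLine.dominated_single z).mono (fun y => le_of_eq ?_) (by simp [multiplicityOn])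
      classical
      simp only [Finsupp.single_apply, Point.onCurve.injEq, true_and]
    · refine ProjLine.dominated_zero.mono (fun y => le_of_eq ?_) (Nat.zero_le _)
      refine Finsupp.single_eq_of_ne fun h => hv ?_
      injection h with h1 h2
      exact h1.symm
  | onEdge a t ht =>
    refine ProjLine.dominated_zero.mono (fun y => le_of_eq ?_) (Nat.zero_le _)
    exact Finsupp.single_eq_of_ne fun h => by cases h

end RationalMetrizedComplex

namespace RankThreeSimpleMatroid

open ProjLine RationalMetrizedComplex

variable {α : Type*} [Fintype α] {M : RankThreeSimpleMatroid α} {k : Type*} [Field k]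
  {C : RationalMetrizedComplex k M.leviGraph}

theorem liftDivisor_inl (x : α → OnePoint k) (e : α) (y : OnePoint k) :
    liftDivisor C x (.onCurve (Sum.inl e) y) = Finsupp.single (x e) (1 : ℤ) y := by
  classical
  rw [liftDivisor, Finsupp.finsetSum_apply, Finset.sum_eq_single e]
  · simp only [Finsupp.single_apply, Point.onCurve.injEq, true_and]
  · intro e' _ he
    refine Finsupp.single_eq_of_ne fun h => he ?_
    injection h with h1 h2
    exact (Sum.inl_injective h1).symm
  · exact fun h => (h (Finset.mem_univ _)).elim

theorem liftDivisor_inr (x : α → OnePoint k) (f : M.Flat) (y : OnePoint k) :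
    liftDivisor C x (.onCurve (Sum.inr f) y) = 0 := by
  rw [liftDivisor, Finsupp.finsetSum_apply]
  refine Finset.sum_eq_zero fun e _ => Finsupp.single_eq_of_ne fun h => ?_
  injection h with h1 h2
  exact Sum.inr_ne_inl h1

theorem liftDivisor_onEdge (x : α → OnePoint k) (p : M.Flag) (t : ℝ) (ht) :
    liftDivisor C x (.onEdge p t ht) = 0 := by
  rw [liftDivisor, Finsupp.finsetSum_apply]
  exact Finset.sum_eq_zero fun e _ => Finsupp.single_eq_of_ne fun h => by cases h

variable (M k) in
/-- A choice of a point on the curve of every element, of two elements of every flat, and of a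
flat through every element. -/
structure SpaceData where
  x : α → OnePoint k
  p₁ : M.Flat → α
  p₂ : M.Flat → α
  hp₁ : ∀ f, p₁ f ∈ f.1
  hp₂ : ∀ f, p₂ f ∈ f.1
  ne : ∀ f, p₁ f ≠ p₂ f
  q : α → M.Flat
  hq : ∀ e, e ∈ (q e).1

namespace SpaceData

variable (S : SpaceData M k)

/-- The points `P` and `Q` can be subtracted from the lift of the matroid divisor with functions
from the explicit spaces. -/
def Subtractable (P Q : C.Point) : Prop :=
  ∃ f : C.RationalFunction,
    (∀ v, f.onCurve v ∈ explicitSpaces C S.x S.p₁ S.p₂ S.hp₁ S.hp₂ S.q S.hq v) ∧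
    ∀ X, 0 ≤ liftDivisor C S.x X - (Finsupp.single P 1 + Finsupp.single Q 1 : C.Divisor) X + f.ord X

variable {S}

theorem Subtractable.symm {P Q : C.Point} (h : S.Subtractable P Q) : S.Subtractable Q P := by
  unfold Subtractable at h ⊢
  rwa [add_comm]

variable (S)

/-- The function on `C_e` which has to be dominated by an effective divisor of degree two, apart
from the divisor to be subtracted. -/
noncomputable def elementBound (C : RationalMetrizedComplex k M.leviGraph) (g : M.ConcaveData) (e : α) (y : OnePoint k) : ℤ :=
  Finsupp.single (C.node ⟨(e, S.q e), S.hq e⟩ false) (1 : ℤ) y +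
    C.nodeSlope g.toPLFunction (Sum.inl e) y

/-- The function on `C_f` which has to be dominated by an effective divisor of degree two, apart
from the divisor to be subtracted. -/
noncomputable def flatBound (C : RationalMetrizedComplex k M.leviGraph) (g : M.ConcaveData) (f : M.Flat) (y : OnePoint k) : ℤ :=
  Finsupp.single (C.node ⟨(S.p₁ f, f), S.hp₁ f⟩ true) (1 : ℤ) y +
    Finsupp.single (C.node ⟨(S.p₂ f, f), S.hp₂ f⟩ true) (1 : ℤ) y +
    C.nodeSlope g.toPLFunction (Sum.inr f) y

variable {S}

/-- The curves decouple once the function on the graph is fixed: each needs a section whose two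
zeros cover its bound together with the points of P, Q on it. Inside edges the kinks have to cover P
and Q, with multiplicity two if they coincide. -/
theorem subtractable_of_dominated (g : M.ConcaveData) {P Q : C.Point}
    (hE : ∀ e, ∃ m, Dominated (S.elementBound C g e) m ∧
      m + P.multiplicityOn (Sum.inl e) + Q.multiplicityOn (Sum.inl e) ≤ 2)
    (hF : ∀ f, ∃ m, Dominated (S.flatBound C g f) m ∧
      m + P.multiplicityOn (Sum.inr f) + Q.multiplicityOn (Sum.inr f) ≤ 2)
    (hP : ∀ p t ht, P = .onEdge p t ht → 1 ≤ g.chip p t)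
    (hQ : ∀ p t ht, Q = .onEdge p t ht → 1 ≤ g.chip p t)
    (hPQ : ∀ p t ht, P = .onEdge p t ht → Q = .onEdge p t ht → 2 ≤ g.chip p t) :
    S.Subtractable P Q := by
  classical
  have hE' : ∀ e, ∃ φ : RatFunc k, φ ≠ 0 ∧
      φ ∈ sections (Finsupp.single (S.x e) 1 +
        Finsupp.single (C.node ⟨(e, S.q e), S.hq e⟩ false) 1) ∧ ∀ y,
      S.elementBound C g e y + (Finsupp.single P (1 : ℤ)) (Point.onCurve (Sum.inl e) y) +
        (Finsupp.single Q (1 : ℤ)) (Point.onCurve (Sum.inl e) y) ≤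
        ordAt φ y + (Finsupp.single (S.x e) (1 : ℤ) y +
          Finsupp.single (C.node ⟨(e, S.q e), S.hq e⟩ false) (1 : ℤ) y) := by
    intro e
    obtain ⟨m, hm, hm2⟩ := hE e
    exact (((hm.add (P.dominated_single _)).add (Q.dominated_single _)).mono
      (fun _ => le_rfl) hm2).exists_section _ _
  have hF' : ∀ f, ∃ φ : RatFunc k, φ ≠ 0 ∧
      φ ∈ sections (Finsupp.single (C.node ⟨(S.p₁ f, f), S.hp₁ f⟩ true) 1 +
        Finsupp.single (C.node ⟨(S.p₂ f, f), S.hp₂ f⟩ true) 1) ∧ ∀ y,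
      S.flatBound C g f y + (Finsupp.single P (1 : ℤ)) (Point.onCurve (Sum.inr f) y) +
        (Finsupp.single Q (1 : ℤ)) (Point.onCurve (Sum.inr f) y) ≤
        ordAt φ y + (Finsupp.single (C.node ⟨(S.p₁ f, f), S.hp₁ f⟩ true) (1 : ℤ) y +
          Finsupp.single (C.node ⟨(S.p₂ f, f), S.hp₂ f⟩ true) (1 : ℤ) y) := by
    intro f
    obtain ⟨m, hm, hm2⟩ := hF f
    exact (((hm.add (P.dominated_single _)).add (Q.dominated_single _)).mono
      (fun _ => le_rfl) hm2).exists_section _ _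
  choose φ hφ0 hφ hφb using hE'
  choose ψ hψ0 hψ hψb using hF'
  refine ⟨⟨g.toPLFunction, Sum.elim φ ψ, by rintro (e | f); exacts [hφ0 e, hψ0 f]⟩,
    by rintro (e | f); exacts [hφ e, hψ f], ?_⟩
  rintro (⟨e | f, y⟩ | ⟨p, t, ht⟩)
  · have h := hφb e y
    rw [RationalFunction.ord_onCurve, liftDivisor_inl, Finsupp.add_apply]
    unfold elementBound at h
    change 0 ≤ _ - _ + (ordAt (φ e) y - C.nodeSlope g.toPLFunction (Sum.inl e) y)
    linarith
  · have h := hψb f y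
    rw [RationalFunction.ord_onCurve, liftDivisor_inr, Finsupp.add_apply]
    unfold flatBound at h
    change 0 ≤ _ - _ + (ordAt (ψ f) y - C.nodeSlope g.toPLFunction (Sum.inr f) y)
    linarith
  · rw [liftDivisor_onEdge, Finsupp.add_apply]
    change 0 ≤ _ - _ + g.chip p t
    have h0 : 0 ≤ g.chip p t := ConcaveProfile.chip_nonneg _ _ _ _
    have h1 := hP p t ht
    have h2 := hQ p t ht
    have h3 := hPQ p t ht
    rw [Finsupp.single_apply, Finsupp.single_apply]
    split_ifs with h4 h5 h5
    · linarith [h3 h4 h5]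
    · linarith [h1 h4]
    · linarith [h2 h5]
    · linarith

end SpaceData

/-! ### Two families of functions on the Levi graph -/

theorem flat_eq_of_mem {f h : M.Flat} {a b : α} (hab : a ≠ b) (h1 : a ∈ f.1) (h2 : b ∈ f.1)
    (h3 : a ∈ h.1) (h4 : b ∈ h.1) : f = h :=
  Subtype.ext ((M.existsUnique_flat a b hab).unique ⟨f.2, h1, h2⟩ ⟨h.2, h3, h4⟩)

namespace ConcaveData

open Classical in
/-- A function which is positive only around the flats `f₁` and `f₂`. -/
noncomputable def twoFlats (f₁ f₂ : M.Flat) (b₁ b₂ : ℝ) (h₁ : 0 ≤ b₁) (h₁' : b₁ ≤ 1) (h₂ : 0 ≤ b₂)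
    (h₂' : b₂ ≤ 1) : M.ConcaveData where
  onElement _ := 0
  onFlat h := if h = f₁ then b₁ else if h = f₂ then b₂ else 0
  level p := if p.1.2 = f₁ then b₁ else if p.1.2 = f₂ then b₂ else 0
  element_le p := by split_ifs <;> linarith
  flat_le p := by split_ifs <;> linarith
  element_le_level p := by split_ifs <;> linarith
  flat_le_level p := le_rfl

open Classical in
/-- A function which is positive only around the flats through the element `w`, with a special
behaviour at one of them. -/
noncomputable def star (w : α) (f : M.Flat) (a b c : ℝ) (h0 : 0 ≤ a) (h2 : a ≤ 2)
    (hb : min a 1 ≤ b) (hb1 : b ≤ 1) (hac : a ≤ c) (hbc : b ≤ c) : M.ConcaveData where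
  onElement e := if e = w then a else 0
  onFlat h := if h = f then b else if w ∈ h.1 then min a 1 else 0
  -- Only the edge from `w` to `f` has a free cap `c`. The cap `a` on the other edges at `w`
  -- prevents a rise away from `w`, and on edges not at `w` the cap at the flat's value prevents a
  -- rise away from the flat.
  level p := if p.1.1 = w then (if p.1.2 = f then c else a) else
    if p.1.2 = f then b else if w ∈ p.1.2.1 then min a 1 else 0
  element_le := by
    rintro ⟨⟨e, h⟩, he⟩
    dsimp only at he ⊢
    split_ifs <;> grind
  flat_le := by
    rintro ⟨⟨e, h⟩, he⟩
    dsimp only at he ⊢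
    split_ifs <;> grind
  element_le_level := by
    rintro ⟨⟨e, h⟩, he⟩
    dsimp only at he ⊢
    split_ifs <;> grind
  flat_le_level := by
    rintro ⟨⟨e, h⟩, he⟩
    dsimp only at he ⊢
    split_ifs <;> grind

section star

variable {w : α} {f : M.Flat} {a b c : ℝ} (h0 : 0 ≤ a) (h2 : a ≤ 2) (hb : min a 1 ≤ b)
  (hb1 : b ≤ 1) (hac : a ≤ c) (hbc : b ≤ c)

theorem star_onElement_self : (star w f a b c h0 h2 hb hb1 hac hbc).onElement w = a :=
  if_pos rfl

theorem star_onElement_of_ne {e : α} (he : e ≠ w) :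
    (star w f a b c h0 h2 hb hb1 hac hbc).onElement e = 0 :=
  if_neg he

theorem star_onFlat_self : (star w f a b c h0 h2 hb hb1 hac hbc).onFlat f = b :=
  if_pos rfl

theorem star_onFlat_of_ne {h : M.Flat} (hf : h ≠ f) (hw : w ∈ h.1) :
    (star w f a b c h0 h2 hb hb1 hac hbc).onFlat h = min a 1 :=
  (if_neg hf).trans (if_pos hw)

theorem star_level_self {p : M.Flag} (hw : p.1.1 = w) (hf : p.1.2 = f) :
    (star w f a b c h0 h2 hb hb1 hac hbc).level p = c :=
  (if_pos hw).trans (if_pos hf)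

theorem star_level_of_flat_ne {p : M.Flag} (hw : p.1.1 = w) (hf : p.1.2 ≠ f) :
    (star w f a b c h0 h2 hb hb1 hac hbc).level p = a :=
  (if_pos hw).trans (if_neg hf)

theorem star_level_of_element_ne {p : M.Flag} (hw : p.1.1 ≠ w) :
    (star w f a b c h0 h2 hb hb1 hac hbc).level p =
      (star w f a b c h0 h2 hb hb1 hac hbc).onFlat p.1.2 :=
  if_neg hw

/-- The divisor of a star on edges which do not end at its center. -/
theorem one_le_chip_star_of_element_ne {p : M.Flag} (hw : p.1.1 ≠ w) {t : ℝ} (ht : t ≤ 1)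
    (hp : (star w f a b c h0 h2 hb hb1 hac hbc).onFlat p.1.2 = t) :
    1 ≤ (star w f a b c h0 h2 hb hb1 hac hbc).chip p t := by
  refine ConcaveProfile.one_le_chip ?_
  rw [star_level_of_element_ne _ _ _ _ _ _ hw, hp, star_onElement_of_ne _ _ _ _ _ _ hw, zero_add]
  exact min_eq_left (by linarith)

/-- The divisor of a star on the special edge. -/
theorem one_le_chip_star_self {p : M.Flag} (hw : p.1.1 = w) (hf : p.1.2 = f) {t : ℝ}
    (ht : min (a + t) (b + 1 - t) = c) :
    1 ≤ (star w f a b c h0 h2 hb hb1 hac hbc).chip p t := by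
  refine ConcaveProfile.one_le_chip ?_
  rw [star_level_self _ _ _ _ _ _ hw hf, hw, hf, star_onElement_self, star_onFlat_self, ht]

theorem two_le_chip_star_self {p : M.Flag} (hw : p.1.1 = w) (hf : p.1.2 = f) {t : ℝ}
    (ht : a + t = b + 1 - t) (ht' : a + t ≤ c) :
    2 ≤ (star w f a b c h0 h2 hb hb1 hac hbc).chip p t := by
  refine ConcaveProfile.two_le_chip ?_ ?_
  · rw [hw, hf, star_onElement_self, star_onFlat_self, ht]
  · rwa [star_level_self _ _ _ _ _ _ hw hf, hw, star_onElement_self]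

/-- The divisor of a star on the other edges which end at its center. -/
theorem one_le_chip_star_of_flat_ne {p : M.Flag} (hw : p.1.1 = w) (hf : p.1.2 ≠ f) {t : ℝ}
    (ht : min (a + t) (min a 1 + 1 - t) = a) :
    1 ≤ (star w f a b c h0 h2 hb hb1 hac hbc).chip p t := by
  refine ConcaveProfile.one_le_chip ?_
  rw [star_level_of_flat_ne _ _ _ _ _ _ hw hf, star_onFlat_of_ne _ _ _ _ _ _ hf (hw ▸ p.2), hw,
    star_onElement_self, ht]

end star

end ConcaveData

namespace SpaceData

variable {S : SpaceData M k}

/-- Edges at `f₁` and `f₂` rise with slope 1 from their element up to height `b₁` or `b₂`, then stay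
level. Since the flats are equal or disjoint, an element sees at most one rising edge. Height 1
makes all slopes at the flat -1, so its curve can absorb both points. -/
theorem subtractable_twoFlats {f₁ f₂ : M.Flat} {b₁ b₂ : ℝ} (h₁ : 0 ≤ b₁) (h₁' : b₁ ≤ 1)
    (h₂ : 0 ≤ b₂) (h₂' : b₂ ≤ 1) (hf : ∀ e, e ∈ f₁.1 → e ∈ f₂.1 → f₁ = f₂) {P Q : C.Point}
    (hE : ∀ e, P.multiplicityOn (Sum.inl e) + Q.multiplicityOn (Sum.inl e) = 0 ∨
      (P.multiplicityOn (Sum.inl e) + Q.multiplicityOn (Sum.inl e) ≤ 1 ∧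
        (e ∈ f₁.1 → b₁ = 0) ∧ (e ∈ f₂.1 → b₂ = 0)))
    (hF : ∀ f, P.multiplicityOn (Sum.inr f) + Q.multiplicityOn (Sum.inr f) = 0 ∨
      (ConcaveData.twoFlats f₁ f₂ b₁ b₂ h₁ h₁' h₂ h₂').onFlat f = 1)
    (hP : ∀ p t ht, P = .onEdge p t ht →
      (ConcaveData.twoFlats f₁ f₂ b₁ b₂ h₁ h₁' h₂ h₂').onFlat p.1.2 = t)
    (hQ : ∀ p t ht, Q = .onEdge p t ht →
      (ConcaveData.twoFlats f₁ f₂ b₁ b₂ h₁ h₁' h₂ h₂').onFlat p.1.2 = t)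
    (hPQ : ∀ p t ht, P = .onEdge p t ht → Q ≠ .onEdge p t ht) :
    S.Subtractable P Q := by
  set g := ConcaveData.twoFlats f₁ f₂ b₁ b₂ h₁ h₁' h₂ h₂' with hg
  have hlevel : ∀ p, g.level p = g.onFlat p.1.2 := fun _ => rfl
  have hzero : ∀ p : M.Flag, (p.1.2 = f₁ → b₁ = 0) → (p.1.2 = f₂ → b₂ = 0) →
      g.elementSlope p ≤ 0 := by
    intro p hp1 hp2
    refine ConcaveProfile.slopeRight_zero_nonpos (Or.inl ?_)
    classical
    change (if p.1.2 = f₁ then b₁ else if p.1.2 = f₂ then b₂ else 0) ≤ 0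
    split_ifs with h3 h4
    exacts [(hp1 h3).le, (hp2 h4).le, le_rfl]
  have hchip : ∀ (p : M.Flag) t, t ∈ Set.Ioo (0 : ℝ) 1 → g.onFlat p.1.2 = t → 1 ≤ g.chip p t := by
    intro p t ht hpt
    refine ConcaveProfile.one_le_chip ?_
    rw [hlevel, hpt]
    change min (0 + t) _ = t
    rw [zero_add, min_eq_left (by linarith [ht.2])]
  refine subtractable_of_dominated g (fun e => ?_) (fun f => ?_)
    (fun p t ht hp => hchip p t ht (hP p t ht hp)) (fun p t ht hp => hchip p t ht (hQ p t ht hp))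
    (fun p t ht hp hq => (hPQ p t ht hp hq).elim)
  · rcases hE e with he | ⟨he, he1, he2⟩
    · refine ⟨2, ?_, by omega⟩
      by_cases h : e ∈ f₁.1
      · refine g.dominated_inl C ⟨(e, S.q e), S.hq e⟩ ⟨(e, f₁), h⟩ fun p hp hne => ?_
        have hpf : p.1.2 ≠ f₁ := fun hpf => hne (Subtype.ext (Prod.ext hp hpf))
        refine hzero p (fun h' => (hpf h').elim) fun h' => (hpf ?_).elim
        rw [h', hf e h (by rw [← h', ← show p.1.1 = e from hp]; exact p.2)]
      · by_cases h' : e ∈ f₂.1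
        · refine g.dominated_inl C ⟨(e, S.q e), S.hq e⟩ ⟨(e, f₂), h'⟩ fun p hp hne => ?_
          refine hzero p (fun hpf => (h ?_).elim) fun hpf => (hne ?_).elim
          · rw [← hpf, ← show p.1.1 = e from hp]; exact p.2
          · exact Subtype.ext (Prod.ext hp hpf)
        · refine (g.dominated_inl_of_nonpos C ⟨(e, S.q e), S.hq e⟩ fun p hp => ?_).mono
            (fun _ => le_rfl) one_le_two
          refine hzero p (fun hpf => (h ?_).elim) fun hpf => (h' ?_).elim <;>
          · rw [← hpf, ← show p.1.1 = e from hp]; exact p.2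
    · refine ⟨1, g.dominated_inl_of_nonpos C ⟨(e, S.q e), S.hq e⟩ fun p hp => ?_, by omega⟩
      refine hzero p (fun hpf => he1 ?_) fun hpf => he2 ?_ <;>
      · rw [← hpf, ← show p.1.1 = e from hp]; exact p.2
  · rcases hF f with h | h
    · refine ⟨2, g.dominated_inr_of_nonpos C (S.hp₁ f) (S.hp₂ f) fun p hp => ?_, by omega⟩
      exact ConcaveProfile.slopeLeft_one_nonpos (Or.inl (hlevel p).le)
    · refine ⟨0, g.dominated_inr_of_neg C (S.hp₁ f) (S.hp₂ f) (S.ne f) fun p hp => ?_, ?_⟩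
      · refine ConcaveProfile.slopeLeft_one_neg ?_ (hlevel p).ge
        rw [hp, h]
        exact (zero_add (1 : ℝ)).le
      · have := P.multiplicityOn_le_one (Sum.inr f)
        have := Q.multiplicityOn_le_one (Sum.inr f)
        omega

/-- The hypotheses record the budgets. The curve of `w` takes one point if `c = a`, as then no edge
rises from `w`, and two points if `a = 2` and `b = 1`, as then all slopes at `w` are -1. A flat at
height 1 has slopes -1 except perhaps towards `w`, so it takes one point if it does not rise towards
`w`. Below height 1 its slopes must be nonpositive, which at `f` is ensured by `hbc'`. -/
theorem subtractable_star {w : α} {f : M.Flat} (hw : w ∈ f.1) {a b c : ℝ} (h0 : 0 ≤ a)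
    (h2 : a ≤ 2) (hb : min a 1 ≤ b) (hb1 : b ≤ 1) (hac : a ≤ c) (hbc : b ≤ c)
    (hbc' : b < 1 → c = b) {P Q : C.Point}
    (hE : ∀ e, e ≠ w → P.multiplicityOn (Sum.inl e) + Q.multiplicityOn (Sum.inl e) = 0)
    (hE' : P.multiplicityOn (Sum.inl w) + Q.multiplicityOn (Sum.inl w) = 0 ∨
      (P.multiplicityOn (Sum.inl w) + Q.multiplicityOn (Sum.inl w) ≤ 1 ∧ c = a) ∨
      (a = 2 ∧ b = 1))
    (hF : P.multiplicityOn (Sum.inr f) + Q.multiplicityOn (Sum.inr f) = 0 ∨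
      (P.multiplicityOn (Sum.inr f) + Q.multiplicityOn (Sum.inr f) ≤ 1 ∧ b = 1 ∧ c = 1))
    (hF' : ∀ h, h ≠ f → P.multiplicityOn (Sum.inr h) + Q.multiplicityOn (Sum.inr h) = 0 ∨
      (P.multiplicityOn (Sum.inr h) + Q.multiplicityOn (Sum.inr h) ≤ 1 ∧ w ∈ h.1 ∧ a = 1))
    (hP : ∀ p t ht, P = .onEdge p t ht →
      1 ≤ (ConcaveData.star w f a b c h0 h2 hb hb1 hac hbc).chip p t)
    (hQ : ∀ p t ht, Q = .onEdge p t ht →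
      1 ≤ (ConcaveData.star w f a b c h0 h2 hb hb1 hac hbc).chip p t)
    (hPQ : ∀ p t ht, P = .onEdge p t ht → Q = .onEdge p t ht →
      2 ≤ (ConcaveData.star w f a b c h0 h2 hb hb1 hac hbc).chip p t) :
    S.Subtractable P Q := by
  set g := ConcaveData.star w f a b c h0 h2 hb hb1 hac hbc with hg
  have hgw : g.onElement w = a := ConcaveData.star_onElement_self ..
  have hgf : g.onFlat f = b := ConcaveData.star_onFlat_self ..
  have hgz : ∀ e, e ≠ w → g.onElement e = 0 :=
    fun e he => ConcaveData.star_onElement_of_ne _ _ _ _ _ _ he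
  have hgh : ∀ h, h ≠ f → w ∈ h.1 → g.onFlat h = min a 1 :=
    fun h h1 h2 => ConcaveData.star_onFlat_of_ne _ _ _ _ _ _ h1 h2
  have hgh' : ∀ h, w ∉ h.1 → g.onFlat h = 0 := by
    intro h h2
    refine (if_neg ?_).trans (if_neg h2)
    rintro rfl
    exact h2 hw
  have hlf : ∀ p : M.Flag, p.1.1 = w → p.1.2 = f → g.level p = c :=
    fun p h1 h2 => ConcaveData.star_level_self _ _ _ _ _ _ h1 h2
  have hlw : ∀ p : M.Flag, p.1.1 = w → p.1.2 ≠ f → g.level p = a :=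
    fun p h1 h2 => ConcaveData.star_level_of_flat_ne _ _ _ _ _ _ h1 h2
  have hl : ∀ p : M.Flag, p.1.1 ≠ w → g.level p = g.onFlat p.1.2 :=
    fun p h1 => ConcaveData.star_level_of_element_ne _ _ _ _ _ _ h1
  refine subtractable_of_dominated g (fun e => ?_) (fun h => ?_) hP hQ hPQ
  · by_cases hew : e = w
    · subst hew
      rcases hE' with h | ⟨h, hc⟩ | ⟨ha, hb⟩
      · refine ⟨2, g.dominated_inl C ⟨(e, S.q e), S.hq e⟩ ⟨(e, f), hw⟩ fun p hp hne => ?_,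
          by omega⟩
        have hpf : p.1.2 ≠ f := fun hpf => hne (Subtype.ext (Prod.ext hp hpf))
        refine ConcaveProfile.slopeRight_zero_nonpos (Or.inl ?_)
        rw [hlw p hp hpf, show p.1.1 = e from hp, hgw]
      · refine ⟨1, g.dominated_inl_of_nonpos C ⟨(e, S.q e), S.hq e⟩ fun p hp => ?_, by omega⟩
        refine ConcaveProfile.slopeRight_zero_nonpos (Or.inl ?_)
        rw [show p.1.1 = e from hp, hgw]
        by_cases hpf : p.1.2 = f
        · rw [hlf p hp hpf, hc]
        · rw [hlw p hp hpf]
      · refine ⟨0, g.dominated_inl_of_neg C ⟨(e, S.q e), S.hq e⟩ fun p hp => ?_, ?_⟩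
        · refine ConcaveProfile.slopeRight_zero_neg ?_ (g.element_le_level p)
          rw [show p.1.1 = e from hp, hgw]
          by_cases hpf : p.1.2 = f
          · rw [hpf, hgf]; linarith
          · rw [hgh _ hpf (by rw [← show p.1.1 = e from hp]; exact p.2)]
            linarith [min_le_right a 1]
        · have := P.multiplicityOn_le_one (Sum.inl e)
          have := Q.multiplicityOn_le_one (Sum.inl e)
          omega
    · obtain ⟨l, ⟨hl1, hl2, hl3⟩, -⟩ := M.existsUnique_flat e w hew
      refine ⟨2, g.dominated_inl C ⟨(e, S.q e), S.hq e⟩ ⟨(e, ⟨l, hl1⟩), hl2⟩ fun p hp hne => ?_,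
        by have := hE e hew; omega⟩
      have hpe : p.1.1 = e := hp
      have hwp : w ∉ p.1.2.1 := fun hwp => hne <| Subtype.ext <| Prod.ext hp <|
        flat_eq_of_mem hew (hpe ▸ p.2) hwp hl2 hl3
      refine ConcaveProfile.slopeRight_zero_nonpos (Or.inl ?_)
      rw [hl p (hpe ▸ hew), hgh' _ hwp, hgz _ (hpe ▸ hew)]
  · by_cases hhf : h = f
    · subst hhf
      rcases hb1.lt_or_eq with hlt | heq
      · refine ⟨2, g.dominated_inr_of_nonpos C (S.hp₁ h) (S.hp₂ h) fun p hp => ?_, ?_⟩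
        · refine ConcaveProfile.slopeLeft_one_nonpos (Or.inl ?_)
          by_cases hpw : p.1.1 = w
          · rw [hlf p hpw hp, hp, hgf, hbc' hlt]
          · exact (hl p hpw).le
        · rcases hF with h | h
          · omega
          · linarith [h.2.1]
      · have hneg : ∀ p : M.Flag, p.1.2 = h → p.1.1 ≠ w → g.flatSlope p ≤ -1 := by
          intro p hp hpw
          refine ConcaveProfile.slopeLeft_one_neg ?_ (g.flat_le_level p)
          rw [hgz _ hpw, hp, hgf, heq, zero_add]
        rcases hF with hF | ⟨hF, -, hc⟩
        · refine ⟨2, g.dominated_inr C (S.hp₁ h) (S.hp₂ h) (S.ne h) hw 2 hneg ?_, by omega⟩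
          have : g.flatSlope ⟨(w, h), hw⟩ ≤ 1 := ConcaveProfile.slopeLeft_le_one _ _ _ _
          push_cast
          linarith
        · refine ⟨1, g.dominated_inr C (S.hp₁ h) (S.hp₂ h) (S.ne h) hw 1 hneg ?_, by omega⟩
          have : g.flatSlope ⟨(w, h), hw⟩ ≤ 0 := by
            refine ConcaveProfile.slopeLeft_one_nonpos (Or.inl ?_)
            rw [hlf _ rfl rfl, hgf, hc, heq]
          push_cast
          linarith
    · by_cases hwh : w ∈ h.1
      -- For `a < 1` the edge from `w` to `h` is level at height `a`; for `a ≥ 1` the flat has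
      -- height 1, and its other edges descend with slope -1.
      · rcases lt_or_ge a 1 with ha | ha
        · refine ⟨2, g.dominated_inr_of_nonpos C (S.hp₁ h) (S.hp₂ h) fun p hp => ?_, ?_⟩
          · refine ConcaveProfile.slopeLeft_one_nonpos (Or.inl ?_)
            by_cases hpw : p.1.1 = w
            · rw [hlw p hpw (hp ▸ hhf), hp, hgh h hhf hwh, min_eq_left ha.le]
            · exact (hl p hpw).le
          · rcases hF' h hhf with h | h
            · omega
            · linarith [h.2.2]
        · have hneg : ∀ p : M.Flag, p.1.2 = h → p.1.1 ≠ w → g.flatSlope p ≤ -1 := by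
            intro p hp hpw
            refine ConcaveProfile.slopeLeft_one_neg ?_ (g.flat_le_level p)
            rw [hgz _ hpw, hp, hgh h hhf hwh, min_eq_right ha, zero_add]
          rcases hF' h hhf with hF | ⟨hF, -, hc⟩
          · refine ⟨2, g.dominated_inr C (S.hp₁ h) (S.hp₂ h) (S.ne h) hwh 2 hneg ?_, by omega⟩
            have : g.flatSlope ⟨(w, h), hwh⟩ ≤ 1 := ConcaveProfile.slopeLeft_le_one _ _ _ _
            push_cast
            linarith
          · refine ⟨1, g.dominated_inr C (S.hp₁ h) (S.hp₂ h) (S.ne h) hwh 1 hneg ?_, by omega⟩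
            have : g.flatSlope ⟨(w, h), hwh⟩ ≤ 0 := by
              refine ConcaveProfile.slopeLeft_one_nonpos (Or.inl ?_)
              rw [hlw _ rfl hhf, hgh h hhf hwh, hc, min_self]
            push_cast
            linarith
      · refine ⟨2, g.dominated_inr_of_nonpos C (S.hp₁ h) (S.hp₂ h) fun p hp => ?_, ?_⟩
        · refine ConcaveProfile.slopeLeft_one_nonpos (Or.inl ?_)
          refine (hl p ?_).le
          rintro hpw
          exact hwh (by rw [← hp, ← hpw]; exact p.2)
        · rcases hF' h hhf with h | h
          · omega
          · exact (hwh h.2.1).elim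

end SpaceData

end RankThreeSimpleMatroid

/-! ### Subtracting two points, by their relative position -/

namespace RankThreeSimpleMatroid

open ProjLine RationalMetrizedComplex

variable {α : Type*} [Fintype α] {M : RankThreeSimpleMatroid α} {k : Type*} [Field k]
  {C : RationalMetrizedComplex k M.leviGraph}

/-- The point `P` lies on the curve of the flat `f` (and `t = 1`) or in the interior of an edge
ending at `f`, at distance `t` from the element of this edge. -/
def IsNearFlat (f : M.Flat) (t : ℝ) (P : C.Point) : Prop :=
  (t = 1 ∧ ∃ y, P = .onCurve (Sum.inr f) y) ∨
    ∃ (p : M.Flag) (ht : t ∈ Set.Ioo 0 (M.leviGraph.length p)), p.1.2 = f ∧ P = .onEdge p t ht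

/-- The point `P` is near the flat `f`, but not on the edge from `f` to `w`. -/
def IsNearFlatOff (w : α) (f : M.Flat) (t : ℝ) (P : C.Point) : Prop :=
  IsNearFlat f t P ∧ ∀ p s hs, P = .onEdge p s hs → p.1.1 ≠ w

namespace IsNearFlat

variable {f : M.Flat} {t : ℝ} {P : C.Point}

theorem pos (h : IsNearFlat f t P) : 0 < t := by
  rcases h with ⟨rfl, -⟩ | ⟨p, ht, -⟩
  exacts [one_pos, ht.1]

theorem le_one (h : IsNearFlat f t P) : t ≤ 1 := by
  rcases h with ⟨rfl, -⟩ | ⟨p, ht, -⟩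
  exacts [le_rfl, ht.2.le]

theorem multiplicityOn_inl (h : IsNearFlat f t P) (e : α) :
    P.multiplicityOn (Sum.inl e) = 0 := by
  rcases h with ⟨rfl, y, rfl⟩ | ⟨p, ht, -, rfl⟩
  · exact Point.multiplicityOn_onCurve_of_ne Sum.inr_ne_inl y
  · rfl

theorem multiplicityOn_inr (h : IsNearFlat f t P) {f' : M.Flat} (hf : f' ≠ f) :
    P.multiplicityOn (Sum.inr f') = 0 := by
  rcases h with ⟨rfl, y, rfl⟩ | ⟨p, ht, -, rfl⟩
  · exact Point.multiplicityOn_onCurve_of_ne (fun h => hf (Sum.inr_injective h).symm) y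
  · rfl

theorem multiplicityOn_self (h : IsNearFlat f t P) :
    P.multiplicityOn (Sum.inr f) = 0 ∨ P.multiplicityOn (Sum.inr f) = 1 ∧ t = 1 := by
  rcases h with ⟨rfl, y, rfl⟩ | ⟨p, ht, -, rfl⟩
  · exact Or.inr ⟨if_pos rfl, rfl⟩
  · exact Or.inl rfl

theorem of_eq_onEdge (h : IsNearFlat f t P) {p : M.Flag} {s : ℝ} {hs}
    (hP : P = .onEdge p s hs) : p.1.2 = f ∧ s = t := by
  rcases h with ⟨rfl, y, rfl⟩ | ⟨p', ht, hp, rfl⟩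
  · cases hP
  · cases hP
    exact ⟨hp, rfl⟩

theorem off_or (h : IsNearFlat f t P) (w : α) (hw : w ∈ f.1) : IsNearFlatOff w f t P ∨
    ∃ ht : t ∈ Set.Ioo 0 (M.leviGraph.length ⟨(w, f), hw⟩), P = .onEdge ⟨(w, f), hw⟩ t ht := by
  by_cases hoff : ∀ p s hs, P = .onEdge p s hs → p.1.1 ≠ w
  · exact Or.inl ⟨h, hoff⟩
  · push Not at hoff
    obtain ⟨p, s, hs, rfl, rfl⟩ := hoff
    obtain ⟨rfl, rfl⟩ := h.of_eq_onEdge rfl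
    exact Or.inr ⟨hs, rfl⟩

end IsNearFlat

theorem isNearFlat_onEdge (p : M.Flag) (t : ℝ) (ht) :
    IsNearFlat p.1.2 t (Point.onEdge p t ht : C.Point) :=
  Or.inr ⟨p, ht, rfl, rfl⟩

theorem isNearFlat_onCurve (f : M.Flat) (y : OnePoint k) :
    IsNearFlat f 1 (Point.onCurve (Sum.inr f) y : C.Point) :=
  Or.inl ⟨rfl, y, rfl⟩

theorem exists_isNearFlat (P : C.Point) :
    (∃ e y, P = .onCurve (Sum.inl e) y) ∨ ∃ f t, IsNearFlat f t P := by
  rcases P with ⟨e | f, y⟩ | ⟨p, t, ht⟩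
  · exact Or.inl ⟨e, y, rfl⟩
  · exact Or.inr ⟨f, 1, isNearFlat_onCurve f y⟩
  · exact Or.inr ⟨p.1.2, t, isNearFlat_onEdge p t ht⟩

theorem multiplicityOn_inr_inl (e : α) (y : OnePoint k) (f : M.Flat) :
    (Point.onCurve (Sum.inl e) y : C.Point).multiplicityOn (Sum.inr f) = 0 :=
  Point.multiplicityOn_onCurve_of_ne Sum.inl_ne_inr y

theorem multiplicityOn_inl_inl {e e' : α} (y : OnePoint k) (h : e' ≠ e) :
    (Point.onCurve (Sum.inl e) y : C.Point).multiplicityOn (Sum.inl e') = 0 :=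
  Point.multiplicityOn_onCurve_of_ne (fun hh => h (Sum.inl_injective hh).symm) y

namespace SpaceData

variable {S : SpaceData M k} {P Q : C.Point} {w : α} {f f' : M.Flat} {t t' : ℝ}

theorem subtractable_element_element_of_ne {e e' : α} (h : e ≠ e') (y y' : OnePoint k) :
    S.Subtractable (.onCurve (Sum.inl e) y : C.Point) (.onCurve (Sum.inl e') y') := by
  -- Heights zero give the zero function on the graph: each element curve can spare one point on its
  -- own, and the flats are irrelevant.
  refine subtractable_twoFlats (f₁ := S.q e) (f₂ := S.q e) (b₁ := 0) (b₂ := 0) le_rfl zero_le_one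
    le_rfl zero_le_one (fun _ _ _ => rfl) (fun e'' => ?_) (fun f => Or.inl ?_) (fun p t ht hp => ?_)
    (fun p t ht hp => ?_) (fun p t ht hp => ?_)
  · refine Or.inr ⟨?_, fun _ => rfl, fun _ => rfl⟩
    by_cases he : e'' = e
    · have := (Point.onCurve (Sum.inl e) y : C.Point).multiplicityOn_le_one (Sum.inl e'')
      rw [multiplicityOn_inl_inl y' (fun h' => h (he.symm.trans h'))]
      omega
    · have := (Point.onCurve (Sum.inl e') y' : C.Point).multiplicityOn_le_one (Sum.inl e'')
      rw [multiplicityOn_inl_inl y he]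
      omega
  · rw [multiplicityOn_inr_inl, multiplicityOn_inr_inl]
  all_goals cases hp

theorem subtractable_element_element (hw : w ∈ f.1) (y y' : OnePoint k) :
    S.Subtractable (.onCurve (Sum.inl w) y : C.Point) (.onCurve (Sum.inl w) y') := by
  refine subtractable_star hw (a := 2) (b := 1) (c := 2) (by norm_num) le_rfl (min_le_right _ _)
    le_rfl le_rfl (by norm_num) (fun h => (lt_irrefl _ h).elim) (fun e he => ?_)
    (Or.inr (Or.inr ⟨rfl, rfl⟩)) (Or.inl ?_) (fun h _ => Or.inl ?_) (fun p t ht hp => ?_)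
    (fun p t ht hp => ?_) (fun p t ht hp => ?_)
  · rw [multiplicityOn_inl_inl y he, multiplicityOn_inl_inl y' he]
  · rw [multiplicityOn_inr_inl, multiplicityOn_inr_inl]
  · rw [multiplicityOn_inr_inl, multiplicityOn_inr_inl]
  all_goals cases hp

theorem subtractable_element_flat_of_notMem {e : α} (he : e ∉ f.1) (y : OnePoint k)
    (hQ : IsNearFlat f t Q) : S.Subtractable (.onCurve (Sum.inl e) y) Q := by
  refine subtractable_twoFlats (f₁ := f) (f₂ := f) (b₁ := t) (b₂ := t) hQ.pos.le hQ.le_one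
    hQ.pos.le hQ.le_one (fun _ _ _ => rfl) (fun e' => ?_) (fun h => ?_) (fun p t ht hp => ?_)
    (fun p s hs hp => ?_) (fun p t ht hp => ?_)
  · rw [hQ.multiplicityOn_inl]
    by_cases h : e' = e
    · subst h
      exact Or.inr ⟨(add_zero _).trans_le (Point.multiplicityOn_le_one _ _), fun h => (he h).elim, fun h => (he h).elim⟩
    · exact Or.inl (by rw [multiplicityOn_inl_inl y h])
  · rw [multiplicityOn_inr_inl, zero_add]
    by_cases h' : h = f
    · subst h'
      exact hQ.multiplicityOn_self.imp_right fun h => (if_pos rfl).trans h.2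
    · exact Or.inl (hQ.multiplicityOn_inr h')
  · cases hp
  · obtain ⟨h1, h2⟩ := hQ.of_eq_onEdge hp
    exact (if_pos h1).trans h2.symm
  · cases hp

theorem subtractable_flat_flat_of_disjoint (h : ∀ e, e ∈ f.1 → e ∉ f'.1)
    (hP : IsNearFlat f t P) (hQ : IsNearFlat f' t' Q) : S.Subtractable P Q := by
  have hne : f' ≠ f := by
    rintro rfl
    exact h _ (S.hp₁ f') (S.hp₁ f')
  refine subtractable_twoFlats (f₁ := f) (f₂ := f') (b₁ := t) (b₂ := t') hP.pos.le hP.le_one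
    hQ.pos.le hQ.le_one (fun e h1 h2 => (h e h1 h2).elim) (fun e => Or.inl ?_) (fun l => ?_)
    (fun p s hs hp => ?_) (fun p s hs hp => ?_) (fun p s hs hp hq => ?_)
  · rw [hP.multiplicityOn_inl, hQ.multiplicityOn_inl]
  · by_cases h1 : l = f
    · subst h1
      rw [hQ.multiplicityOn_inr hne.symm, add_zero]
      exact hP.multiplicityOn_self.imp_right fun h => (if_pos rfl).trans h.2
    · rw [hP.multiplicityOn_inr h1, zero_add]
      by_cases h2 : l = f'
      · subst h2
        exact hQ.multiplicityOn_self.imp_right fun h =>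
          (if_neg hne).trans ((if_pos rfl).trans h.2)
      · exact Or.inl (hQ.multiplicityOn_inr h2)
  · obtain ⟨h1, h2⟩ := hP.of_eq_onEdge hp
    exact (if_pos h1).trans h2.symm
  · obtain ⟨h1, h2⟩ := hQ.of_eq_onEdge hp
    exact (if_neg (h1 ▸ hne)).trans ((if_pos h1).trans h2.symm)
  · exact hne ((hQ.of_eq_onEdge hq).1.symm.trans (hP.of_eq_onEdge hp).1)

theorem subtractable_curve_curve (f : M.Flat) (y y' : OnePoint k) :
    S.Subtractable (.onCurve (Sum.inr f) y : C.Point) (.onCurve (Sum.inr f) y') := by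
  have hP := isNearFlat_onCurve (C := C) f y
  have hQ := isNearFlat_onCurve (C := C) f y'
  refine subtractable_twoFlats (f₁ := f) (f₂ := f) (b₁ := 1) (b₂ := 1) zero_le_one le_rfl
    zero_le_one le_rfl (fun _ _ _ => rfl) (fun e => Or.inl ?_) (fun l => ?_)
    (fun p s hs hp => ?_) (fun p s hs hp => ?_) (fun p s hs hp hq => ?_)
  · rw [hP.multiplicityOn_inl, hQ.multiplicityOn_inl]
  · by_cases h : l = f
    · exact Or.inr (if_pos h)
    · exact Or.inl (by rw [hP.multiplicityOn_inr h, hQ.multiplicityOn_inr h])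
  all_goals cases hp

/-- The star has height `2 - t` from `w` up to distance `t` on every edge at `w`, then descends to
1. This kinks at Q and never rises from `w`. -/
theorem subtractable_element_edge (hw : w ∈ f.1) (y : OnePoint k) (ht) :
    S.Subtractable (.onCurve (Sum.inl w) y) (.onEdge ⟨(w, f), hw⟩ t ht : C.Point) := by
  have h0 : 0 < t := ht.1
  have h1 : t < 1 := ht.2
  have hQ := isNearFlat_onEdge (C := C) ⟨(w, f), hw⟩ t ht
  refine subtractable_star hw (a := 2 - t) (b := 1) (c := 2 - t) (by linarith) (by linarith)
    (min_le_right _ _) le_rfl le_rfl (by linarith) (fun h => (lt_irrefl _ h).elim)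
    (fun e he => ?_) (Or.inr (Or.inl ⟨?_, rfl⟩)) (Or.inl ?_) (fun h _ => Or.inl ?_)
    (fun p s hs hp => ?_) (fun p s hs hp => ?_) (fun p s hs hp => ?_)
  · rw [multiplicityOn_inl_inl y he, hQ.multiplicityOn_inl]
  · rw [hQ.multiplicityOn_inl]
    exact Point.multiplicityOn_le_one (Sum.inl w) (.onCurve (Sum.inl w) y : C.Point)
  · exact multiplicityOn_inr_inl (C := C) w y f
  · exact multiplicityOn_inr_inl (C := C) w y h
  · cases hp
  · cases hp
    refine ConcaveData.one_le_chip_star_self _ _ _ _ _ _ rfl rfl ?_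
    rw [min_eq_right] <;> linarith
  · cases hp

/-- All edges at `w` are level at height `t`, and the edges from `f` to other elements kink at
distance `t` from these. -/
theorem subtractable_element_flat (hw : w ∈ f.1) (y : OnePoint k) (hQ : IsNearFlatOff w f t Q) :
    S.Subtractable (.onCurve (Sum.inl w) y) Q := by
  obtain ⟨hQ, hoff⟩ := hQ
  have h0 := hQ.pos
  have h1 := hQ.le_one
  refine subtractable_star hw (a := t) (b := t) (c := t) h0.le (by linarith)
    (min_le_left _ _) h1 le_rfl le_rfl (fun _ => rfl) (fun e he => ?_) (Or.inr (Or.inl ⟨?_, rfl⟩))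
    ?_ (fun h hf => Or.inl ?_) (fun p s hs hp => ?_) (fun p s hs hp => ?_) (fun p s hs hp => ?_)
  · rw [multiplicityOn_inl_inl y he, hQ.multiplicityOn_inl]
  · rw [hQ.multiplicityOn_inl]
    exact Point.multiplicityOn_le_one (Sum.inl w) (.onCurve (Sum.inl w) y : C.Point)
  · rw [multiplicityOn_inr_inl, zero_add]
    exact hQ.multiplicityOn_self.imp_right fun h => ⟨h.1.le, h.2, h.2⟩
  · rw [multiplicityOn_inr_inl, hQ.multiplicityOn_inr hf]
  · cases hp
  · have hpw := hoff p s hs hp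
    obtain ⟨hpf, rfl⟩ := hQ.of_eq_onEdge hp
    refine ConcaveData.one_le_chip_star_of_element_ne _ _ _ _ _ _ hpw h1 ?_
    rw [hpf, ConcaveData.star_onFlat_self]
  · cases hp

/-- Height `t` at `w` makes the edges of `f` off `w` kink at `t`; only `f'` is raised further, to
`t'`. -/
theorem subtractable_off_off (hne : f ≠ f') (hw : w ∈ f.1) (hw' : w ∈ f'.1)
    (hP : IsNearFlatOff w f t P) (hQ : IsNearFlatOff w f' t' Q) (htt' : t ≤ t') :
    S.Subtractable P Q := by
  obtain ⟨hP, hPw⟩ := hP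
  obtain ⟨hQ, hQw⟩ := hQ
  have h0 := hP.pos
  have h1 := hQ.le_one
  have h2 := hQ.pos
  refine subtractable_star hw' (a := t) (b := t') (c := t') h0.le (by linarith)
    ((min_le_left _ _).trans htt') h1 htt' le_rfl (fun _ => rfl) (fun e he => ?_) (Or.inl ?_)
    ?_ (fun h hf => ?_) (fun p s hs hp => ?_) (fun p s hs hp => ?_) (fun p s hs hp hq => ?_)
  · rw [hP.multiplicityOn_inl, hQ.multiplicityOn_inl]
  · rw [hP.multiplicityOn_inl, hQ.multiplicityOn_inl]
  · rw [hP.multiplicityOn_inr hne.symm, zero_add]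
    exact hQ.multiplicityOn_self.imp_right fun h => ⟨h.1.le, h.2, h.2⟩
  · rw [hQ.multiplicityOn_inr hf, add_zero]
    by_cases h' : h = f
    · subst h'
      exact hP.multiplicityOn_self.imp_right fun h => ⟨h.1.le, hw, h.2⟩
    · exact Or.inl (hP.multiplicityOn_inr h')
  · have hpw := hPw p s hs hp
    obtain ⟨rfl, rfl⟩ := hP.of_eq_onEdge hp
    refine ConcaveData.one_le_chip_star_of_element_ne _ _ _ _ _ _ hpw hP.le_one ?_
    rw [ConcaveData.star_onFlat_of_ne _ _ _ _ _ _ hne hw, min_eq_left hP.le_one]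
  · have hpw := hQw p s hs hp
    obtain ⟨rfl, rfl⟩ := hQ.of_eq_onEdge hp
    refine ConcaveData.one_le_chip_star_of_element_ne _ _ _ _ _ _ hpw h1 ?_
    rw [ConcaveData.star_onFlat_self]
  · exact (hne ((hP.of_eq_onEdge hp).1.symm.trans (hQ.of_eq_onEdge hq).1)).elim

/-- With height `t' - t` at `w`, the edge to `f` rises with slope 1 and reaches the plateau `t'`
exactly at P, while the other edges at `f` kink at distance `t'`. -/
theorem subtractable_edge_off (hw : w ∈ f.1) (ht) (hQ : IsNearFlatOff w f t' Q) (htt' : t ≤ t') :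
    S.Subtractable (.onEdge ⟨(w, f), hw⟩ t ht) Q := by
  obtain ⟨hQ, hQw⟩ := hQ
  have h0 : 0 < t := ht.1
  have h1 := hQ.le_one
  have h2 := hQ.pos
  have hP := isNearFlat_onEdge (C := C) ⟨(w, f), hw⟩ t ht
  refine subtractable_star hw (a := t' - t) (b := t') (c := t') (by linarith) (by linarith)
    ((min_le_left _ _).trans (by linarith)) h1 (by linarith) le_rfl (fun _ => rfl) (fun e he => ?_)
    (Or.inl ?_) ?_ (fun h hf => Or.inl ?_) (fun p s hs hp => ?_) (fun p s hs hp => ?_)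
    (fun p s hs hp hq => ?_)
  · rw [hP.multiplicityOn_inl, hQ.multiplicityOn_inl]
  · rw [hP.multiplicityOn_inl, hQ.multiplicityOn_inl]
  · rw [show (Point.onEdge ⟨(w, f), hw⟩ t ht : C.Point).multiplicityOn (Sum.inr f) = 0 from rfl,
      zero_add]
    exact hQ.multiplicityOn_self.imp_right fun h => ⟨h.1.le, h.2, h.2⟩
  · rw [hP.multiplicityOn_inr hf, hQ.multiplicityOn_inr hf]
  · cases hp
    refine ConcaveData.one_le_chip_star_self _ _ _ _ _ _ rfl rfl ?_
    have : t < 1 := ht.2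
    rw [min_eq_left] <;> linarith
  · have hpw := hQw p s hs hp
    obtain ⟨rfl, rfl⟩ := hQ.of_eq_onEdge hp
    refine ConcaveData.one_le_chip_star_of_element_ne _ _ _ _ _ _ hpw h1 ?_
    rw [ConcaveData.star_onFlat_self]
  · refine (hQw p s hs hq ?_).elim
    cases hp
    rfl

theorem subtractable_edge_off_of_ne (hne : f ≠ f') (hw : w ∈ f.1) (hw' : w ∈ f'.1) (ht)
    (hQ : IsNearFlatOff w f' t' Q) : S.Subtractable (.onEdge ⟨(w, f), hw⟩ t ht) Q := by
  obtain ⟨hQ, hQw⟩ := hQ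
  have h0 : 0 < t := ht.1
  have h0' : t < 1 := ht.2
  have h1 := hQ.le_one
  have h2 := hQ.pos
  have hP := isNearFlat_onEdge (C := C) ⟨(w, f), hw⟩ t ht
  -- Height `t'` at `w` gives the flat `f'` height `t'`, hence the kink at Q. On the edge to `f` the
  -- cap is the height of the uncut tent at `t`, which forces a kink at P; `f` is raised by `t` as
  -- far as height 1 allows, so that `b < 1` entails `c = b`.
  refine subtractable_star hw (a := t') (b := min 1 (t + t'))
    (c := min (t' + t) (min 1 (t + t') + 1 - t)) h2.le (by linarith)
    ((min_le_left _ _).trans (le_min h1 (by linarith))) (min_le_left _ _)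
    (by grind) (by grind) (by grind) (fun e he => ?_)
    (Or.inl ?_) (Or.inl ?_) (fun h hf => ?_) (fun p s hs hp => ?_) (fun p s hs hp => ?_)
    (fun p s hs hp hq => ?_)
  · rw [hP.multiplicityOn_inl, hQ.multiplicityOn_inl]
  · rw [hP.multiplicityOn_inl, hQ.multiplicityOn_inl]
  · rw [hQ.multiplicityOn_inr hne]; rfl
  · rw [hP.multiplicityOn_inr hf, zero_add]
    by_cases h' : h = f'
    · subst h'
      exact hQ.multiplicityOn_self.imp_right fun h => ⟨h.1.le, hw', h.2⟩
    · exact Or.inl (hQ.multiplicityOn_inr h')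
  · cases hp
    exact ConcaveData.one_le_chip_star_self _ _ _ _ _ _ rfl rfl rfl
  · have hpw := hQw p s hs hp
    obtain ⟨rfl, rfl⟩ := hQ.of_eq_onEdge hp
    refine ConcaveData.one_le_chip_star_of_element_ne _ _ _ _ _ _ hpw h1 ?_
    rw [ConcaveData.star_onFlat_of_ne _ _ _ _ _ _ hne.symm hw', min_eq_left h1]
  · exact (hne ((hP.of_eq_onEdge hp).1.symm.trans (hQ.of_eq_onEdge hq).1)).elim

theorem subtractable_edge_edge (hw : w ∈ f.1) (ht ht') (htt' : t ≤ t') :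
    S.Subtractable (.onEdge ⟨(w, f), hw⟩ t ht : C.Point) (.onEdge ⟨(w, f), hw⟩ t' ht') := by
  have h0 : 0 < t := ht.1
  have h0' : t' < 1 := ht'.2
  -- The two sides `a + s` and `2 - s` of the tent have height `2 - t'` at `s = t` and `s = t'`;
  -- cutting there gives both kinks, or the apex with multiplicity two if `t = t'`.
  refine subtractable_star hw (a := 2 - t - t') (b := 1) (c := 2 - t') (by linarith)
    (by linarith) (min_le_right _ _) le_rfl (by linarith) (by linarith)
    (fun h => (lt_irrefl _ h).elim) (fun e he => rfl)
    (Or.inl rfl) (Or.inl rfl) (fun h hf => Or.inl rfl) (fun p s hs hp => ?_) (fun p s hs hp => ?_)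
    (fun p s hs hp hq => ?_)
  · cases hp
    refine ConcaveData.one_le_chip_star_self _ _ _ _ _ _ rfl rfl ?_
    rw [min_eq_left] <;> linarith
  · cases hp
    refine ConcaveData.one_le_chip_star_self _ _ _ _ _ _ rfl rfl ?_
    rw [min_eq_right] <;> linarith
  · cases hp
    cases hq
    exact ConcaveData.two_le_chip_star_self _ _ _ _ _ _ rfl rfl (by linarith) (by linarith)

theorem subtractable_edge_edge_of_ne (hne : f ≠ f') (hw : w ∈ f.1) (hw' : w ∈ f'.1) (ht ht')
    (htt' : t ≤ t') :
    S.Subtractable (.onEdge ⟨(w, f), hw⟩ t ht : C.Point) (.onEdge ⟨(w, f'), hw'⟩ t' ht') := by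
  have h0 : 0 < t := ht.1
  have h0' : t' < 1 := ht'.2
  -- Level height `2 - t'` meets the descent `2 - s` at `s = t'`, giving the kink at Q on every edge
  -- at `w` except the special one, where the cap is the height of the tent at `t`. That this cap is
  -- at least `a` uses `t ≤ t'`.
  refine subtractable_star hw (a := 2 - t') (b := 1) (c := min (2 - t' + t) (1 + 1 - t))
    (by linarith) (by linarith) (min_le_right _ _) le_rfl
    (le_min (by linarith) (by linarith)) (le_min (by linarith) (by linarith))
    (fun h => (lt_irrefl _ h).elim) (fun e he => rfl)
    (Or.inl rfl) (Or.inl rfl) (fun h hf => Or.inl rfl) (fun p s hs hp => ?_) (fun p s hs hp => ?_)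
    (fun p s hs hp hq => ?_)
  · cases hp
    exact ConcaveData.one_le_chip_star_self _ _ _ _ _ _ rfl rfl rfl
  · cases hp
    refine ConcaveData.one_le_chip_star_of_flat_ne _ _ _ _ _ _ rfl hne.symm ?_
    rw [min_eq_right (a := 2 - t') (by linarith), min_eq_right] <;> linarith
  · cases hp
    cases hq
    exact (hne rfl).elim

theorem subtractable_flat_flat_of_ne (hne : f ≠ f') (hP : IsNearFlat f t P)
    (hQ : IsNearFlat f' t' Q) : S.Subtractable P Q := by
  by_cases h : ∀ e, e ∈ f.1 → e ∉ f'.1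
  · exact subtractable_flat_flat_of_disjoint h hP hQ
  push Not at h
  obtain ⟨w, hw, hw'⟩ := h
  rcases hP.off_or w hw with hP | ⟨ht, rfl⟩ <;> rcases hQ.off_or w hw' with hQ | ⟨ht', rfl⟩
  · rcases le_total t t' with htt' | htt'
    · exact subtractable_off_off hne hw hw' hP hQ htt'
    · exact (subtractable_off_off hne.symm hw' hw hQ hP htt').symm
  · exact (subtractable_edge_off_of_ne hne.symm hw' hw ht' hP).symm
  · exact subtractable_edge_off_of_ne hne hw hw' ht hQ
  · rcases le_total t t' with htt' | htt'
    · exact subtractable_edge_edge_of_ne hne hw hw' ht ht' htt'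
    · exact (subtractable_edge_edge_of_ne hne.symm hw' hw ht' ht htt').symm

/-- The star is centred at the element of the edge carrying the point farther from the flat. If P
lies on the curve of `f` then `t = 1`, so Q lies there too. -/
theorem subtractable_flat_flat_of_le (hP : IsNearFlat f t P) (hQ : IsNearFlat f t' Q)
    (htt' : t ≤ t') : S.Subtractable P Q := by
  rcases hP with ⟨rfl, y, rfl⟩ | ⟨⟨⟨w, f⟩, hw⟩, ht, rfl, rfl⟩
  · rcases hQ with ⟨-, y', rfl⟩ | ⟨p, ht', rfl, rfl⟩
    · exact subtractable_curve_curve f y y'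
    · exact (htt'.not_gt ht'.2).elim
  · rcases hQ.off_or w hw with hQ | ⟨ht', rfl⟩
    · exact subtractable_edge_off hw ht hQ htt'
    · exact subtractable_edge_edge hw ht ht' htt'

/-- Any two points can be subtracted from a lift of the matroid divisor. -/
theorem subtractable (S : SpaceData M k) (P Q : C.Point) : S.Subtractable P Q := by
  have key : ∀ (e : α) (y : OnePoint k) (f : M.Flat) (t : ℝ) (Q : C.Point), IsNearFlat f t Q →
      S.Subtractable (.onCurve (Sum.inl e) y) Q := by
    intro e y f t Q hQ
    by_cases he : e ∈ f.1
    · rcases hQ.off_or e he with hQ | ⟨ht, rfl⟩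
      · exact subtractable_element_flat he y hQ
      · exact subtractable_element_edge he y ht
    · exact subtractable_element_flat_of_notMem he y hQ
  rcases exists_isNearFlat P with ⟨e, y, rfl⟩ | ⟨f, t, hP⟩ <;>
    rcases exists_isNearFlat Q with ⟨e', y', rfl⟩ | ⟨f', t', hQ⟩
  · by_cases he : e = e'
    · subst he
      exact subtractable_element_element (S.hq e) y y'
    · exact subtractable_element_element_of_ne he y y'
  · exact key e y f' t' Q hQ
  · exact (key e' y' f t P hP).symm
  · by_cases hf : f = f'
    · subst hf
      rcases le_total t t' with htt' | htt'
      · exact subtractable_flat_flat_of_le hP hQ htt'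
      · exact (subtractable_flat_flat_of_le hQ hP htt').symm
    · exact subtractable_flat_flat_of_ne hf hP hQ

end SpaceData

end RankThreeSimpleMatroid

/-! ### Degrees of divisors and the upper bound on the rank -/

namespace RationalMetrizedComplex

section Degree

variable {k : Type*} [Field k] {V A : Type*} {Γ : MetricGraph V A}
  {C : RationalMetrizedComplex k Γ}

theorem degree_add (D E : C.Divisor) : degree (D + E) = degree D + degree E :=
  Finsupp.sum_add_index' (fun _ => rfl) (fun _ _ _ => rfl)

theorem degree_single (P : C.Point) (n : ℤ) : degree (Finsupp.single P n : C.Divisor) = n :=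
  Finsupp.sum_single_index rfl

theorem degree_sum {ι : Type*} (s : Finset ι) (D : ι → C.Divisor) :
    degree (∑ i ∈ s, D i) = ∑ i ∈ s, degree (D i) :=
  map_sum (AddMonoidHom.mk' (degree (C := C)) degree_add) D s

theorem exists_eq_single_add {E : C.Divisor} (h0 : 0 ≤ E) (h : 0 < degree E) :
    ∃ (P : C.Point) (E' : C.Divisor), 0 ≤ E' ∧ E = Finsupp.single P 1 + E' := by
  obtain ⟨P, hP⟩ : ∃ P, 0 < E P := by
    by_contra! hle
    exact h.not_ge (Finset.sum_nonpos fun P _ => hle P)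
  refine ⟨P, E - Finsupp.single P 1, fun Q => ?_, (add_sub_cancel _ _).symm⟩
  classical
  have := h0 Q
  rw [Finsupp.sub_apply, Finsupp.single_apply]
  rw [Finsupp.zero_apply] at this ⊢
  split_ifs with hQ
  · subst hQ
    omega
  · omega

theorem eq_zero_of_degree_eq_zero {E : C.Divisor} (h0 : 0 ≤ E) (h : degree E = 0) : E = 0 := by
  by_contra hne
  obtain ⟨P, hP⟩ := Finsupp.ne_iff.1 hne
  have h1 : degree E = 0 ↔ _ := Finset.sum_eq_zero_iff_of_nonneg fun Q _ => h0 Q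
  exact hP (h1.1 h P (Finsupp.mem_support_iff.2 hP))

theorem exists_eq_single_add_single {E : C.Divisor} (h0 : 0 ≤ E) (h : degree E = 2) :
    ∃ P Q : C.Point, E = Finsupp.single P 1 + Finsupp.single Q 1 := by
  obtain ⟨P, E₁, h1, rfl⟩ := exists_eq_single_add h0 (by omega)
  rw [degree_add, degree_single] at h
  obtain ⟨Q, E₂, h2, rfl⟩ := exists_eq_single_add h1 (by omega)
  rw [degree_add, degree_single] at h
  rw [eq_zero_of_degree_eq_zero h2 (by omega), add_zero]
  exact ⟨P, Q, rfl⟩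

end Degree

/-- If `D` has no points on `C_v` and nonzero functions in `H_v` have at most two zeros, then the
restricted rank is at most two. -/
theorem RestrictedRankGE.le_two {k : Type*} [Field k] [IsAlgClosed k] {V A : Type*} [Fintype A]
    {Γ : MetricGraph V A} {C : RationalMetrizedComplex k Γ} {D : C.Divisor}
    {H : V → Submodule k (RatFunc k)} {s : ℕ} (h : C.RestrictedRankGE D H s) (v : V)
    (hD : ∀ y, D (.onCurve v y) = 0)
    (hH : ∀ φ ∈ H v, ∀ t : Finset k, 2 < t.card →
      (∀ a ∈ t, 0 < ProjLine.ordAt φ (a : OnePoint k)) → φ = 0) : s ≤ 2 := by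
  classical
  by_contra! hs
  -- Away from the nodes the slopes do not contribute to the divisor, so at `s` distinct such points
  -- the function on `C_v` itself must vanish.
  have hfin : {a : k | ∃ h : A × Bool, C.node h.1 h.2 = (a : OnePoint k)}.Finite :=
    (Set.finite_range fun h : A × Bool => C.node h.1 h.2).preimage
      (OnePoint.coe_injective.injOn) |>.subset fun a ha => ha
  have : Infinite k := IsAlgClosed.instInfinite
  obtain ⟨t, ht, hcard⟩ := hfin.infinite_compl.exists_subset_card_eq s
  let E : C.Divisor := ∑ a ∈ t, Finsupp.single (.onCurve v (a : OnePoint k)) 1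
  have hE : ∀ P, E P = ∑ a ∈ t, (Finsupp.single (.onCurve v (a : OnePoint k)) 1 : C.Divisor) P :=
    fun P => Finsupp.finsetSum_apply _ _ _
  have hnn : ∀ (a : k) (P : C.Point),
      0 ≤ (Finsupp.single (.onCurve v (a : OnePoint k)) 1 : C.Divisor) P := by
    intro a P
    rw [Finsupp.single_apply]
    split_ifs <;> simp
  have hE0 : 0 ≤ E := by
    intro P
    rw [hE]
    exact Finset.sum_nonneg fun a _ => hnn a P
  have hdeg : degree E = s := by
    rw [degree_sum]
    simp only [degree_single]
    rw [Finset.sum_const, hcard]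
    simp
  obtain ⟨f, hf, hpos⟩ := h E hE0 hdeg
  refine f.onCurve_ne_zero v (hH _ (hf v) t (by omega) fun a ha => ?_)
  have h1 := hpos (.onCurve v (a : OnePoint k))
  have h2 : 1 ≤ E (.onCurve v (a : OnePoint k)) := by
    rw [hE]
    refine le_trans (le_of_eq ?_) (Finset.single_le_sum (fun b _ => hnn b _) ha)
    rw [Finsupp.single_eq_same]
  rw [hD, RationalFunction.ord_onCurve, C.nodeSlope_eq_zero _ _ _ fun b c hbc =>
    ht ha ⟨(b, c), hbc⟩] at h1
  omega

end RationalMetrizedComplex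

/-! ### The limit linear series and existence of the choices -/

namespace RankThreeSimpleMatroid

open RationalMetrizedComplex

variable {α : Type*} [Fintype α] {M : RankThreeSimpleMatroid α} {k : Type*} [Field k]

theorem degree_liftDivisor (C : RationalMetrizedComplex k M.leviGraph) (x : α → OnePoint k) :
    degree (liftDivisor C x) = Fintype.card α := by
  rw [liftDivisor, degree_sum]
  simp only [degree_single]
  simp

theorem SpaceData.isLimitLinearSeries [IsAlgClosed k] (S : SpaceData M k)
    (C : RationalMetrizedComplex k M.leviGraph) :
    C.IsLimitLinearSeries 2 (Fintype.card α) (liftDivisor C S.x)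
      (explicitSpaces C S.x S.p₁ S.p₂ S.hp₁ S.hp₂ S.q S.hq) where
  degree_eq := degree_liftDivisor C S.x
  finrank_eq := by
    rintro (e | f)
    exacts [ProjLine.finrank_sections _ _, ProjLine.finrank_sections _ _]
  rank_eq := by
    constructor
    · intro E hE hdeg
      obtain ⟨P, Q, rfl⟩ := exists_eq_single_add_single hE hdeg
      exact S.subtractable P Q
    · intro s hs
      obtain ⟨f, hf⟩ := Finset.card_pos.1 (two_pos.trans_le M.two_le_card_flats)
      exact RestrictedRankGE.le_two hs (Sum.inr ⟨f, hf⟩) (liftDivisor_inr _ _)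
        fun φ hφ t ht hpos => ProjLine.eq_zero_of_ordAt_pos hφ t ht hpos

theorem nonempty_spaceData (M : RankThreeSimpleMatroid α) (K : Type*) :
    Nonempty (SpaceData M K) := by
  have hflat : ∀ f : M.Flat, ∃ a b, a ∈ f.1 ∧ b ∈ f.1 ∧ a ≠ b := fun f => by
    obtain ⟨a, ha, b, hb, hab⟩ := Finset.one_lt_card.1 (M.two_le_card f.1 f.2)
    exact ⟨a, b, ha, hb, hab⟩
  obtain ⟨f, hf⟩ := Finset.card_pos.1 (two_pos.trans_le M.two_le_card_flats)
  obtain ⟨a, b, -, -, hab⟩ := hflat ⟨f, hf⟩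
  -- A flat through `e` is found by joining it to some other element, which exists since a flat has
  -- two.
  have helement : ∀ e, ∃ h : M.Flat, e ∈ h.1 := fun e => by
    obtain ⟨e', he'⟩ : ∃ e', e ≠ e' := by
      by_cases h : e = a
      · exact ⟨b, h ▸ hab⟩
      · exact ⟨a, h⟩
    obtain ⟨h, ⟨h1, h2, -⟩, -⟩ := M.existsUnique_flat e e' he'
    exact ⟨⟨h, h1⟩, h2⟩
  choose p₁ p₂ hp₁ hp₂ hne using hflat
  choose q hq using helement
  exact ⟨⟨fun _ => OnePoint.infty, p₁, p₂, hp₁, hp₂, hne, q, hq⟩⟩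

end RankThreeSimpleMatroid

theorem proposition1p4 {k : Type*} [Field k] [IsAlgClosed k] {α : Type*} [Fintype α]
    (M : RankThreeSimpleMatroid α) (C : RationalMetrizedComplex k M.leviGraph) :
    (∃ (x : α → OnePoint k) (H : α ⊕ M.Flat → Submodule k (RatFunc k)),
      C.IsLimitLinearSeries 2 (Fintype.card α) (RankThreeSimpleMatroid.liftDivisor C x) H) ∧
    ∀ (x : α → OnePoint k) (p₁ p₂ : M.Flat → α)
      (hp₁ : ∀ f, p₁ f ∈ f.1) (hp₂ : ∀ f, p₂ f ∈ f.1) (_ : ∀ f, p₁ f ≠ p₂ f)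
      (q : α → M.Flat) (hq : ∀ e, e ∈ (q e).1),
      C.IsLimitLinearSeries 2 (Fintype.card α) (RankThreeSimpleMatroid.liftDivisor C x)
        (RankThreeSimpleMatroid.explicitSpaces C x p₁ p₂ hp₁ hp₂ q hq) := by
  constructor
  · obtain ⟨S⟩ := RankThreeSimpleMatroid.nonempty_spaceData M k
    exact ⟨S.x, _, S.isLimitLinearSeries C⟩
  · intro x p₁ p₂ hp₁ hp₂ hne q hq
    exact RankThreeSimpleMatroid.SpaceData.isLimitLinearSeries ⟨x, p₁, p₂, hp₁, hp₂, hne, q, hq⟩ C
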